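/- Let $g(t)=2^{1/4}e^{-\pi t^2}$. The spectrogram (with window $g$) of a signal $y$ on $\mathbb{R}$ is $$\mathrm{Spec}_g(y)(z)=\left|\int_{\mathbb{R}} y(t)\,g(t-\tau)\,e^{-2i\pi\omega t}\,\mathrm{d}t\right|^2,\qquad z=\tau+i\omega\in\mathbb{C},$$ where for a tempered distribution $y$ the integral is the duality pairing of $y$ with the Schwartz function $t\mapsto g(t-\tau)e^{-2i\pi\omega t}$. Let $\xi$ be a complex white Gaussian noise on $\mathbb{R}$, i.e. a random tempered distribution such that, for every Schwartz function $\varphi$, $\langle\xi,\varphi\rangle$ is a circularly symmetric complex Gaussian variable with mean $0$ and $\mathbb{E}|\langle\xi,\varphi\rangle|^2=\|\varphi\|_{L^2}^2$. A function $\rho:\mathbb{C}\to\mathbb{R}_+$ is the density (intensity) of the zeros of $\mathrm{Spec}_g(Y)$, for a random tempered distribution $Y$, if for every bounded Borel set $A\subset\mathbb{C}$ the number $N(A)$ of zeros of $\mathrm{Spec}_g(Y)$ in $A$ is almost surely equal to a random variable and satisfies $\mathbb{E}[N(A)]=\int_A\rho(z)\,\mathrm{d}z$, where $\mathrm{d}z$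 is Lebesgue measure on $\mathbb{C}\cong\mathbb{R}^2$. Let $a,b\in\mathbb{R}$, let $\gamma>0$, let $x(t)=e^{2i\pi t(a+bt)}$ be the linear chirp, and let $\sigma_b=\sqrt{\frac{2}{1+4b^2}}$. Then the density of the zeros of $\mathrm{Spec}_g(\xi+\sqrt{\gamma}\,x)$, as a function of $z=\tau+i\omega$, only depends on $$r:=\frac{\sigma_b}{\sqrt2}\bigl(\omega-(a+2b\tau)\bigr),$$ which is the signed distance between $z$ and the line $\omega=a+2b\tau$ (that is, $|r|$ is the distance, and $r>0$ if and only if $\omega>a+2b\tau$). Furthermore, it is given by $$\rho(r)=\left(1+4\pi\gamma\sigma_b r^2e^{-2\pi r^2}\right)\exp\left(-\gamma\sigma_b e^{-2\pi r^2}\right).$$ -/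

import Mathlib

open MeasureTheory ProbabilityTheory Complex
open scoped SchwartzMap NNReal ENNReal

noncomputable section

namespace ChirpZeros

/-! ### Gaussian window and time-frequency atoms -/

/-- The Gaussian window `g(t) = 2^{1/4} e^{-π t²}`. -/
def window (t : ℝ) : ℂ := (((2 : ℝ) ^ (1 / 4 : ℝ) * Real.exp (-Real.pi * t ^ 2) : ℝ) : ℂ)

theorem contDiff_window {n : WithTop ℕ∞} : ContDiff ℝ n window := by
  refine Complex.ofRealCLM.contDiff.comp
    (f := fun t : ℝ => (2 : ℝ) ^ (1 / 4 : ℝ) * Real.exp (-Real.pi * t ^ 2)) ?_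
  fun_prop

theorem iteratedDeriv_window (n : ℕ) :
    ∃ P : Polynomial ℝ, ∀ t : ℝ, iteratedDeriv n window t = (P.eval t : ℝ) * window t := by
  induction n with
  | zero => exact ⟨1, fun t => by simp⟩
  | succ n ih =>
    obtain ⟨P, hP⟩ := ih
    refine ⟨Polynomial.derivative P + P * (Polynomial.C (-2 * Real.pi) * Polynomial.X),
      fun t => ?_⟩
    rw [iteratedDeriv_succ, funext hP]
    have h1 : HasDerivAt (fun t : ℝ => ((P.eval t : ℝ) : ℂ))
        (((Polynomial.derivative P).eval t : ℝ) : ℂ) t := (P.hasDerivAt t).ofReal_comp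
    have h2 : HasDerivAt window (((-2 * Real.pi * t : ℝ) : ℂ) * window t) t := by
      have h3 : HasDerivAt (fun t : ℝ => (2 : ℝ) ^ (1 / 4 : ℝ) * Real.exp (-Real.pi * t ^ 2))
          ((2 : ℝ) ^ (1 / 4 : ℝ) *
            (Real.exp (-Real.pi * t ^ 2) * (-Real.pi * ((2 : ℕ) * t ^ 1)))) t := by
        exact (((hasDerivAt_pow 2 t).const_mul (-Real.pi)).exp).const_mul ((2 : ℝ) ^ (1 / 4 : ℝ))
      refine HasDerivAt.congr_deriv (f := window) h3.ofReal_comp ?_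
      rw [window]
      push_cast
      ring
    refine (h1.mul h2).deriv.trans ?_
    simp only [Polynomial.eval_add, Polynomial.eval_mul, Polynomial.eval_C, Polynomial.eval_X]
    push_cast
    ring

theorem window_decay (k n : ℕ) : ∃ C, ∀ t : ℝ, ‖t‖ ^ k * ‖iteratedFDeriv ℝ n window t‖ ≤ C := by
  obtain ⟨P, hP⟩ := iteratedDeriv_window n
  have hq : ∀ Q : Polynomial ℝ, ∃ C, ∀ t : ℝ, |Q.eval t| * Real.exp (-Real.pi * t ^ 2) ≤ C := by
    intro Q
    induction Q using Polynomial.induction_on' with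
    | add p q hp hq =>
      obtain ⟨C, hC⟩ := hp
      obtain ⟨D, hD⟩ := hq
      refine ⟨C + D, fun t => ?_⟩
      rw [Polynomial.eval_add]
      calc _ ≤ (|p.eval t| + |q.eval t|) * Real.exp (-Real.pi * t ^ 2) := by
              gcongr; exact abs_add_le _ _
        _ ≤ _ := by rw [add_mul]; exact add_le_add (hC t) (hD t)
    | monomial m c =>
      refine ⟨|c| * (m.factorial * Real.exp 1), fun t => ?_⟩
      rw [Polynomial.eval_monomial, abs_mul, mul_assoc]
      refine mul_le_mul_of_nonneg_left ?_ (abs_nonneg c)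
      have h1 : |t| ^ m / m.factorial ≤ Real.exp |t| := Real.pow_div_factorial_le_exp _ (abs_nonneg t) m
      have h2 : |t| ^ m ≤ m.factorial * Real.exp |t| := by
        rw [div_le_iff₀ (by positivity)] at h1; linarith
      rw [abs_pow]
      calc |t| ^ m * Real.exp (-Real.pi * t ^ 2)
          ≤ (m.factorial * Real.exp |t|) * Real.exp (-Real.pi * t ^ 2) := by gcongr
        _ = m.factorial * Real.exp (|t| + -Real.pi * t ^ 2) := by rw [Real.exp_add]; ring
        _ ≤ m.factorial * Real.exp 1 := by
            gcongr
            have := Real.pi_gt_three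
            nlinarith [sq_abs t, sq_nonneg (|t| - 1), sq_nonneg t]
  obtain ⟨C, hC⟩ := hq (Polynomial.X ^ k * P)
  refine ⟨(2 : ℝ) ^ (1 / 4 : ℝ) * C, fun t => ?_⟩
  rw [norm_iteratedFDeriv_eq_norm_iteratedDeriv, hP]
  have h0 : (0 : ℝ) ≤ (2 : ℝ) ^ (1 / 4 : ℝ) := by positivity
  have h1 := mul_le_mul_of_nonneg_left (hC t) h0
  refine le_trans (le_of_eq ?_) h1
  rw [norm_mul, window, Complex.norm_real, Complex.norm_real, Polynomial.eval_mul,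
    Polynomial.eval_pow, Polynomial.eval_X, abs_mul, abs_pow, Real.norm_eq_abs, Real.norm_eq_abs,
    Real.norm_eq_abs, abs_mul, abs_of_nonneg h0, abs_of_pos (Real.exp_pos _)]
  ring

/-- The Gaussian window as a Schwartz function. -/
def windowSchwartz : 𝓢(ℝ, ℂ) where
  toFun := window
  smooth' := contDiff_window
  decay' := window_decay

theorem hasTemperateGrowth_cexp_mul_I :
    Function.HasTemperateGrowth fun s : ℝ => cexp (s * I) := by
  refine ⟨(Complex.ofRealCLM.contDiff.mul contDiff_const).cexp, fun n => ⟨0, 1, fun t => ?_⟩⟩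
  have h : ∀ n : ℕ, iteratedDeriv n (fun s : ℝ => cexp (s * I)) =
      fun s : ℝ => I ^ n * cexp (s * I) := by
    intro n
    induction n with
    | zero => ext s; simp
    | succ n ih =>
      ext s
      rw [iteratedDeriv_succ, ih]
      have h1 : HasDerivAt (fun s : ℝ => cexp (s * I)) (cexp (s * I) * (1 * I)) s :=
        (((hasDerivAt_id (s : ℂ)).mul_const I).cexp).comp_ofReal
      rw [(h1.const_mul (I ^ n)).deriv]
      ring
  rw [norm_iteratedFDeriv_eq_norm_iteratedDeriv, h, norm_mul, norm_pow, Complex.norm_I,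
    Complex.norm_exp_ofReal_mul_I]
  simp

theorem hasTemperateGrowth_modulation (ω : ℝ) :
    Function.HasTemperateGrowth fun t : ℝ => cexp (-2 * I * Real.pi * ω * t) := by
  have hp : Function.HasTemperateGrowth fun t : ℝ => (-2 * Real.pi * ω) * t :=
    (Function.HasTemperateGrowth.const _).mul Function.HasTemperateGrowth.id'
  convert hasTemperateGrowth_cexp_mul_I.comp hp using 1
  ext t
  simp only [Function.comp_apply]
  congr 1
  push_cast
  ring

theorem atom_eq (z : ℂ) :
    (fun t : ℝ => window (t - z.re) * cexp (-2 * I * Real.pi * z.im * t)) =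
      ⇑(SchwartzMap.smulLeftCLM ℂ (fun t : ℝ => cexp (-2 * I * Real.pi * z.im * t))
        (SchwartzMap.compSubConstCLM ℂ z.re windowSchwartz)) := by
  ext t
  rw [SchwartzMap.smulLeftCLM_apply_apply (hasTemperateGrowth_modulation z.im),
    SchwartzMap.compSubConstCLM_apply, smul_eq_mul, mul_comm]
  rfl

/-- The time-frequency atom `t ↦ g(t - τ) e^{-2iπωt}` at `z = τ + iω`, as a Schwartz function. -/
def atom (z : ℂ) : 𝓢(ℝ, ℂ) where
  toFun := fun t : ℝ => window (t - z.re) * cexp (-2 * I * Real.pi * z.im * t)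
  smooth' := by
    rw [atom_eq]
    exact SchwartzMap.smooth _ _
  decay' := by
    rw [atom_eq]
    exact SchwartzMap.decay'
      (SchwartzMap.smulLeftCLM ℂ (fun t : ℝ => cexp (-2 * I * Real.pi * z.im * t))
        (SchwartzMap.compSubConstCLM ℂ z.re windowSchwartz))

/-! ### Spectrogram -/

/-- The spectrogram, with Gaussian window, of a tempered distribution `y`:
`z = τ + iω ↦ |⟨y, g(· - τ) e^{-2iπω·}⟩|²`. -/
def spectrogram (y : 𝓢'(ℝ, ℂ)) (z : ℂ) : ℝ := ‖y (atom z)‖ ^ 2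

/-- On functions of temperate growth, the spectrogram is given by the usual integral. -/
theorem spectrogram_toTemperedDistribution {f : ℝ → ℂ} (hf : f.HasTemperateGrowth) (z : ℂ) :
    spectrogram hf.toTemperedDistribution z =
      ‖∫ t : ℝ, f t * window (t - z.re) * cexp (-2 * I * Real.pi * z.im * t)‖ ^ 2 := by
  have h : Function.HasTemperateGrowth.toTemperedDistribution volume hf (atom z) = ∫ t : ℝ, atom z t • f t :=
    Function.HasTemperateGrowth.toTemperedDistribution_apply volume hf (atom z)
  rw [spectrogram, h]
  congr 3
  ext t
  change window (t - z.re) * cexp (-2 * I * Real.pi * z.im * t) * f t = _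
  ring

/-! ### Complex white Gaussian noise -/

/-- The circularly symmetric complex Gaussian law `N_ℂ(0, v)` : real and imaginary parts are
independent centred Gaussians of variance `v / 2`, so that `E|Z|² = v`. -/
def complexGaussian (v : ℝ≥0) : Measure ℂ :=
  ((gaussianReal 0 (v / 2)).prod (gaussianReal 0 (v / 2))).map fun p : ℝ × ℝ => (p.1 : ℂ) + p.2 * I

/-- `ξ` is a complex white Gaussian noise on the real line: a random tempered distribution
with `⟨ξ, φ⟩ ~ N_ℂ(0, ‖φ‖²_{L²})` for every Schwartz function `φ`.
As `φ ↦ ⟨ξ, φ⟩` is complex linear, it follows that the family `(⟨ξ, φ⟩)_φ` is jointly complex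
Gaussian and circularly symmetric, with covariance `E[⟨ξ, φ⟩ conj ⟨ξ, ψ⟩] = ∫ φ conj ψ`. -/
structure IsComplexWhiteNoise {Ω : Type*} [MeasurableSpace Ω] (μ : Measure Ω)
    (ξ : Ω → 𝓢'(ℝ, ℂ)) : Prop where
  measurable : ∀ φ : 𝓢(ℝ, ℂ), Measurable fun ω => ξ ω φ
  law : ∀ φ : 𝓢(ℝ, ℂ),
    μ.map (fun ω => ξ ω φ) = complexGaussian (Real.toNNReal (∫ t : ℝ, ‖φ t‖ ^ 2))

/-! ### Intensity of the zeros -/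

/-- The number of zeros of the spectrogram of `y` in `A`. -/
def zeroCount (y : 𝓢'(ℝ, ℂ)) (A : Set ℂ) : ℝ≥0∞ :=
  (({z : ℂ | z ∈ A ∧ spectrogram y z = 0}.encard : ℕ∞) : ℝ≥0∞)

/-- `ρ` is the intensity of the zeros of the spectrogram of the random signal `Y`: for every
bounded Borel set `A`, the number `N(A)` of zeros in `A` is a random variable and
`E[N(A)] = ∫_A ρ`. -/
structure HasZeroIntensity {Ω : Type*} [MeasurableSpace Ω] (μ : Measure Ω)
    (Y : Ω → 𝓢'(ℝ, ℂ)) (ρ : ℂ → ℝ) : Prop where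
  measurable : Measurable ρ
  nonneg : ∀ z, 0 ≤ ρ z
  aemeasurable_zeroCount : ∀ A : Set ℂ, Bornology.IsBounded A → MeasurableSet A →
    AEMeasurable (fun ω => zeroCount (Y ω) A) μ
  lintegral_zeroCount : ∀ A : Set ℂ, Bornology.IsBounded A → MeasurableSet A →
    ∫⁻ ω, zeroCount (Y ω) A ∂μ = ∫⁻ z in A, ENNReal.ofReal (ρ z)

/-! ### The linear chirp -/

/-- The linear chirp `x(t) = e^{2iπ t (a + b t)}`. -/
def chirp (a b : ℝ) (t : ℝ) : ℂ := cexp (2 * I * Real.pi * t * (a + b * t))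

theorem hasTemperateGrowth_chirp (a b : ℝ) : (chirp a b).HasTemperateGrowth := by
  have hp : Function.HasTemperateGrowth fun t : ℝ => (2 * Real.pi) * (t * (a + b * t)) :=
    (Function.HasTemperateGrowth.const _).mul (Function.HasTemperateGrowth.id'.mul
      ((Function.HasTemperateGrowth.const _).add
        ((Function.HasTemperateGrowth.const _).mul Function.HasTemperateGrowth.id')))
  convert hasTemperateGrowth_cexp_mul_I.comp hp using 1
  ext t
  simp only [chirp, Function.comp_apply]
  congr 1
  push_cast
  ring

/-- The linear chirp as a tempered distribution. -/
def chirpDistribution (a b : ℝ) : 𝓢'(ℝ, ℂ) :=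
  (hasTemperateGrowth_chirp a b).toTemperedDistribution

/-- `σ_b = √(2 / (1 + 4 b²))`. -/
def sigma (b : ℝ) : ℝ := Real.sqrt (2 / (1 + 4 * b ^ 2))

/-- The coordinate `r = (σ_b / √2) (ω - (a + 2 b τ))` of `z = τ + iω`. -/
def chirpCoord (a b : ℝ) (z : ℂ) : ℝ :=
  sigma b / Real.sqrt 2 * (z.im - (a + 2 * b * z.re))

/-- The density `ρ(r) = (1 + 4πγσ_b r² e^{-2πr²}) exp(-γσ_b e^{-2πr²})`. -/
def zeroDensity (b γ r : ℝ) : ℝ :=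
  (1 + 4 * Real.pi * γ * sigma b * r ^ 2 * Real.exp (-2 * Real.pi * r ^ 2)) *
    Real.exp (-(γ * sigma b * Real.exp (-2 * Real.pi * r ^ 2)))

/-- The line `ω = a + 2 b τ`. -/
def chirpLine (a b : ℝ) : Set ℂ := {z : ℂ | z.im = a + 2 * b * z.re}

end ChirpZeros

end

namespace ChirpZeros

/-! ### Counting preimages and zeros of entire functions. -/

section Counting

open Set Filter Topology

/-! ### Area formula for holomorphic maps, with multiplicity -/

/-! Up to a nonvanishing factor, the atom at `z` is the Bargmann kernel at the conjugate of `z`.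
Pairing a tempered distribution with `kernel w` gives an entire function of `w`
(`hasDerivAt_kernel`). The zeros of the spectrogram are therefore the conjugates of the zeros of the
random entire function `F(w) = ξ(kernel w) + x(kernel w)`, where `x` denotes the scaled chirp.

The expected number of zeros follows from a Kac–Rice argument in which a single Gaussian variable
does the smoothing. The inner product of `kernel 0` with `kernel w` equals 1 for every `w`, so
`kernel 0` is a unit vector orthogonal to all `kernel w - kernel 0` and all `kernelDeriv w`. Hence
`F = ζ + f`, with `ζ = ξ(kernel 0)` standard complex Gaussian and independent of the random entire
function `f` (`IsComplexWhiteNoise.indepFun`). For fixed `f`, the zeros of `ζ + f` are the preimages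
of `ζ` under `-f`. The area formula `lintegral_count_fiber`, weighted by the density of `ζ`, turns
their mean number in `A` into `∫_A π⁻¹ exp(-|f|²) |f'|²`. Critical points do no harm, since critical
values are null. By Fubini it remains to average over `f`.

At each `w` the pair `(f(w), f'(w))` is Gaussian, with covariances read off from the reproducing
kernel `exp(π w ū)`; completing the square gives the closed form of
`IsComplexWhiteNoise.lintegral_kernel`. For the unscaled chirp, the Bargmann transform is an
explicit Gaussian integral. Its weighted squared modulus is `σ_b exp(-2πr²)`
(`norm_chirpDistribution_kernel_sq`), and its logarithmic derivative minus `π w̄` has squared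
modulus `4π²r²` (`norm_chirp_log_deriv_sq`). Everything thus depends on `r` alone. -/

theorem det_smul_one_complex (c : ℂ) : (c • (1 : ℂ →L[ℝ] ℂ)).det = ‖c‖ ^ 2 := by
  rw [ContinuousLinearMap.det, ← LinearMap.det_toMatrix basisOneI, Matrix.det_fin_two]
  simp [LinearMap.toMatrix_apply, Complex.sq_norm, normSq_apply]

theorem exists_nhds_injOn {h : ℂ → ℂ} (hh : Differentiable ℂ h) {w : ℂ} (hw : deriv h w ≠ 0) :
    ∃ U, IsOpen U ∧ w ∈ U ∧ InjOn h U := by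
  have hs : HasStrictDerivAt h (deriv h w) w :=
    (hh.contDiff (n := 1)).contDiffAt.hasStrictDerivAt one_ne_zero
  obtain ⟨U, hU, hUo, hwU⟩ := eventually_nhds_iff.1 (hs.eventually_left_inverse hw)
  exact ⟨U, hUo, hwU, fun x hx y hy hxy => (hU x hx).symm.trans ((congrArg _ hxy).trans (hU y hy))⟩

theorem count_fiber_of_injOn {h : ℂ → ℂ} {A : Set ℂ} (hi : InjOn h A) (u : ℂ) :
    Measure.count (A ∩ h ⁻¹' {u}) = (h '' A).indicator (1 : ℂ → ℝ≥0∞) u := by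
  classical
  by_cases hu : u ∈ h '' A
  · obtain ⟨w, hw, rfl⟩ := hu
    have : A ∩ h ⁻¹' {h w} = {w} := by
      ext v
      simp only [mem_inter_iff, mem_preimage, mem_singleton_iff]
      exact ⟨fun ⟨hv, e⟩ => hi hv hw e, fun e => by rw [e]; exact ⟨hw, rfl⟩⟩
    rw [this, Measure.count_singleton, indicator_of_mem (mem_image_of_mem h hw), Pi.one_apply]
  · rw [indicator_of_notMem hu]
    convert measure_empty (μ := Measure.count (α := ℂ))
    ext v
    simp only [mem_inter_iff, mem_preimage, mem_singleton_iff, mem_empty_iff_false, iff_false]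
    exact fun ⟨hv, e⟩ => hu ⟨v, hv, e⟩

theorem lintegral_count_fiber_of_injOn {h : ℂ → ℂ} (hh : Differentiable ℂ h) {A : Set ℂ}
    (hA : MeasurableSet A) (hi : InjOn h A) (φ : ℂ → ℝ≥0∞) :
    ∫⁻ u, φ u * Measure.count (A ∩ h ⁻¹' {u}) =
      ∫⁻ w in A, ENNReal.ofReal (‖deriv h w‖ ^ 2) * φ (h w) := by
  have hm : MeasurableSet (h '' A) := hA.image_of_continuousOn_injOn hh.continuous.continuousOn hi
  have h1 := lintegral_image_eq_lintegral_abs_det_fderiv_mul volume hA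
    (fun w _ => (hh w).hasDerivAt.complexToReal_fderiv.hasFDerivWithinAt) hi φ
  simp only [det_smul_one_complex, abs_pow, abs_norm] at h1
  rw [← h1, ← lintegral_indicator hm]
  refine lintegral_congr fun u => ?_
  rw [count_fiber_of_injOn hi]
  by_cases hu : u ∈ h '' A <;> simp [hu]

theorem measurable_count_fiber_of_injOn {h : ℂ → ℂ} (hh : Differentiable ℂ h) {A : Set ℂ}
    (hA : MeasurableSet A) (hi : InjOn h A) :
    Measurable fun u => Measure.count (A ∩ h ⁻¹' {u}) := by
  simp_rw [count_fiber_of_injOn hi]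
  exact measurable_one.indicator
    (hA.image_of_continuousOn_injOn hh.continuous.continuousOn hi)

/-- Area formula for an entire function: integrating the number of preimages in `A`. -/
theorem lintegral_count_fiber {h : ℂ → ℂ} (hh : Differentiable ℂ h) {A : Set ℂ}
    (hA : MeasurableSet A) {φ : ℂ → ℝ≥0∞} (hφ : Measurable φ) :
    ∫⁻ u, φ u * Measure.count (A ∩ h ⁻¹' {u}) =
      ∫⁻ w in A, ENNReal.ofReal (‖deriv h w‖ ^ 2) * φ (h w) := by
  classical
  have hd : Measurable (deriv h) := measurable_deriv h
  set C : Set ℂ := {w | deriv h w = 0} with hC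
  have hCm : MeasurableSet C := hd (measurableSet_singleton 0)
  have hfib : ∀ u, MeasurableSet (h ⁻¹' {u}) := fun u =>
    hh.continuous.measurable (measurableSet_singleton u)
  -- the critical part
  have hcrit : ∀ᵐ u : ℂ, Measure.count (A ∩ C ∩ h ⁻¹' {u}) = 0 := by
    -- Easy case of Sard's theorem: the image of the critical set is null, so almost every `u` has
    -- no critical preimage.
    have h0 : volume (h '' (A ∩ C)) = 0 :=
      addHaar_image_eq_zero_of_det_fderivWithin_eq_zero volume
        (fun w _ => (hh w).hasDerivAt.complexToReal_fderiv.hasFDerivWithinAt)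
        (fun w hw => by rw [det_smul_one_complex, hw.2]; simp)
    filter_upwards [measure_eq_zero_iff_ae_notMem.1 h0] with u hu
    convert measure_empty (μ := Measure.count (α := ℂ))
    ext v
    simp only [mem_inter_iff, mem_preimage, mem_singleton_iff, mem_empty_iff_false, iff_false]
    exact fun ⟨hv, e⟩ => hu ⟨v, hv, e⟩
  -- a countable cover of the regular part
  have hcov : ∃ U : ℕ → Set ℂ, (∀ n, IsOpen (U n) ∧ InjOn h (U n)) ∧ Cᶜ ⊆ ⋃ n, U n := by
    have : ∀ w : ℂ, ∃ U, (IsOpen U ∧ InjOn h U) ∧ (w ∈ Cᶜ → U ∈ 𝓝 w) := by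
      intro w
      by_cases hw : w ∈ C
      · exact ⟨∅, by simp, fun h => absurd hw h⟩
      · obtain ⟨U, hUo, hwU, hi⟩ := exists_nhds_injOn hh hw
        exact ⟨U, ⟨hUo, hi⟩, fun _ => hUo.mem_nhds hwU⟩
    choose U hU hU' using this
    obtain ⟨t, ht, hcover⟩ := TopologicalSpace.countable_cover_nhdsWithin
      (s := Cᶜ) (f := U) (fun w hw => mem_nhdsWithin_of_mem_nhds (hU' w hw))
    obtain ⟨ht2, hcover⟩ := hcover
    rcases t.eq_empty_or_nonempty with rfl | hne
    · exact ⟨fun _ => ∅, by simp, by simpa using hcover⟩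
    · obtain ⟨e, rfl⟩ := ht2.exists_eq_range hne
      exact ⟨fun n => U (e n), fun n => hU _, by simpa using hcover⟩
  obtain ⟨U, hU, hcover⟩ := hcov
  -- Disjoint pieces on which `h` is injective, so that fibre counts add up without repetition.
  set B : ℕ → Set ℂ := fun n => A ∩ Cᶜ ∩ disjointed U n with hB
  have hBm : ∀ n, MeasurableSet (B n) := fun n =>
    (hA.inter hCm.compl).inter (MeasurableSet.disjointed (fun n => (hU n).1.measurableSet) n)
  have hBi : ∀ n, InjOn h (B n) := fun n =>
    (hU n).2.mono (inter_subset_right.trans (disjointed_subset U n))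
  have hBd : Pairwise (Function.onFun Disjoint B) := fun i j hij =>
    (disjoint_disjointed U hij).mono inter_subset_right inter_subset_right
  have hBU : ⋃ n, B n = A ∩ Cᶜ := by
    rw [hB, ← inter_iUnion, iUnion_disjointed]
    exact inter_eq_left.2 (inter_subset_right.trans hcover)
  have hsplit : ∀ᵐ u : ℂ, φ u * Measure.count (A ∩ h ⁻¹' {u}) =
      ∑' n, φ u * Measure.count (B n ∩ h ⁻¹' {u}) := by
    filter_upwards [hcrit] with u hu
    have e : A ∩ h ⁻¹' {u} = (A ∩ C ∩ h ⁻¹' {u}) ∪ ⋃ n, (B n ∩ h ⁻¹' {u}) := by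
      rw [← iUnion_inter, hBU, ← union_inter_distrib_right, inter_union_compl]
    have hz : A ∩ C ∩ h ⁻¹' {u} = ∅ := by
      simpa [Measure.count_eq_zero_iff] using hu
    rw [e, hz, empty_union, ENNReal.tsum_mul_left, measure_iUnion]
    · exact fun i j hij => (hBd hij).mono inter_subset_left inter_subset_left
    · exact fun n => (hBm n).inter (hfib u)
  rw [lintegral_congr_ae hsplit, lintegral_tsum (f := fun n u =>
    φ u * Measure.count (B n ∩ h ⁻¹' {u})) fun n =>
      (hφ.mul (measurable_count_fiber_of_injOn hh (hBm n) (hBi n))).aemeasurable]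
  simp_rw [lintegral_count_fiber_of_injOn hh (hBm _) (hBi _) φ]
  rw [← lintegral_iUnion hBm hBd, hBU, ← lintegral_inter_add_sdiff (μ := volume) _ A hCm,
    setLIntegral_congr_fun (s := A ∩ C) (g := fun _ => 0) (hA.inter hCm)
      (fun w hw => by simp [show deriv h w = 0 from hw.2])]
  simp [sdiff_eq]

/-! ### Measurability of the number of zeros of a random entire function -/

variable {S : Type*} [MeasurableSpace S]

/-- On a compact set a continuous function has a zero exactly when its modulus takes arbitrarily
small values, and this can be tested on a countable dense subset. -/
theorem measurableSet_exists_zero_of_isCompact {F : S → ℂ → ℂ} (hc : ∀ s, Continuous (F s))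
    (hm : ∀ w, Measurable fun s => F s w) {K : Set ℂ} (hK : IsCompact K) :
    MeasurableSet {s | ∃ w ∈ K, F s w = 0} := by
  obtain ⟨t, htK, htc, htd⟩ := TopologicalSpace.IsSeparable.exists_countable_dense_subset
    (TopologicalSpace.IsSeparable.of_separableSpace K)
  have : {s | ∃ w ∈ K, F s w = 0} = ⋂ n : ℕ, ⋃ w ∈ t, {s | ‖F s w‖ < 1 / (n + 1)} := by
    ext s
    simp only [mem_ofPred_eq, mem_iInter, mem_iUnion, exists_prop]
    constructor
    · rintro ⟨w, hw, h0⟩ n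
      have hO : IsOpen {v | ‖F s v‖ < 1 / ((n : ℝ) + 1)} :=
        isOpen_lt (hc s).norm continuous_const
      have hwO : w ∈ {v | ‖F s v‖ < 1 / ((n : ℝ) + 1)} := by
        simp only [mem_ofPred_eq, h0, norm_zero]; positivity
      obtain ⟨v, hv, hvt⟩ := mem_closure_iff.1 (htd hw) _ hO hwO
      exact ⟨v, hvt, hv⟩
    · intro h
      have hne : K.Nonempty := by
        obtain ⟨w, hw, -⟩ := h 0
        exact ⟨w, htK hw⟩
      obtain ⟨w, hw, hmin⟩ := hK.exists_isMinOn hne (hc s).norm.continuousOn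
      refine ⟨w, hw, ?_⟩
      by_contra h0
      obtain ⟨n, hn⟩ := exists_nat_one_div_lt (norm_pos_iff.2 h0)
      obtain ⟨v, hv, hlt⟩ := h n
      exact absurd (hmin (htK hv)) (not_le.2 (hlt.trans hn))
  rw [this]
  exact MeasurableSet.iInter fun n => MeasurableSet.biUnion htc fun w _ =>
    measurableSet_lt (hm w).norm measurable_const

/-- A countable family of closed balls forming a basis of neighbourhoods. -/
noncomputable def rationalBall (i : ℕ × ℕ) : Set ℂ :=
  Metric.closedBall (TopologicalSpace.denseSeq ℂ i.1) (1 / (i.2 + 1))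

theorem exists_rationalBall {w : ℂ} {U : Set ℂ} (hU : U ∈ 𝓝 w) :
    ∃ i, w ∈ rationalBall i ∧ rationalBall i ⊆ U := by
  obtain ⟨ε, hε, hball⟩ := Metric.mem_nhds_iff.1 hU
  obtain ⟨n, hn⟩ := exists_nat_one_div_lt (half_pos hε)
  obtain ⟨k, hk⟩ := (TopologicalSpace.denseRange_denseSeq ℂ).exists_dist_lt w
    (show (0 : ℝ) < 1 / ((n : ℝ) + 1) by positivity)
  refine ⟨(k, n), hk.le, fun v hv => hball ?_⟩
  have h1 : dist v (TopologicalSpace.denseSeq ℂ k) ≤ 1 / ((n : ℝ) + 1) := hv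
  rw [Metric.mem_ball]
  linarith [dist_triangle_right v w (TopologicalSpace.denseSeq ℂ k)]

/-- Finitely many distinct zeros can be enclosed in disjoint rational balls inside `U`; conversely,
disjoint balls that each meet the zero set contain at least as many zeros as there are balls. The
count is therefore a supremum, over a countable index set, of finite sums of measurable indicators.
-/
theorem measurable_count_zeros_of_isOpen {F : S → ℂ → ℂ} (hc : ∀ s, Continuous (F s))
    (hm : ∀ w, Measurable fun s => F s w) {U : Set ℂ} (hU : IsOpen U) :
    Measurable fun s => Measure.count (U ∩ F s ⁻¹' {0}) := by
  classical
  let T := {t : Finset (ℕ × ℕ) //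
    (t : Set (ℕ × ℕ)).PairwiseDisjoint rationalBall ∧ ∀ i ∈ t, rationalBall i ⊆ U}
  have key : ∀ s, Measure.count (U ∩ F s ⁻¹' {0}) =
      ⨆ t : T, ∑ i ∈ t.1, {s | ∃ w ∈ rationalBall i, F s w = 0}.indicator (1 : S → ℝ≥0∞) s := by
    intro s
    have hZm : MeasurableSet (F s ⁻¹' {0}) := (hc s).measurable (measurableSet_singleton 0)
    apply le_antisymm
    · have hle : ∀ P : Finset ℂ, (P : Set ℂ) ⊆ U ∩ F s ⁻¹' {0} → (P.card : ℝ≥0∞) ≤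
          ⨆ t : T, ∑ i ∈ t.1,
            {s | ∃ w ∈ rationalBall i, F s w = 0}.indicator (1 : S → ℝ≥0∞) s := by
        intro P hP
        obtain ⟨V, hV, hVd⟩ := P.finite_toSet.t2_separation
        have : ∀ p : ℂ, ∃ i, p ∈ P → p ∈ rationalBall i ∧ rationalBall i ⊆ V p ∩ U := by
          intro p
          by_cases hp : p ∈ P
          · obtain ⟨i, hi⟩ := exists_rationalBall
              (((hV p).2.inter hU).mem_nhds ⟨(hV p).1, (hP hp).1⟩)
            exact ⟨i, fun _ => hi⟩
          · exact ⟨0, fun h => absurd h hp⟩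
        choose i hi using this
        have hinj : InjOn i P := by
          intro p hp q hq e
          by_contra hpq
          exact disjoint_left.1 (hVd hp hq hpq) ((hi p hp).2 (hi p hp).1).1
            ((hi q hq).2 (e ▸ (hi p hp).1)).1
        refine le_trans ?_ (le_iSup _ (⟨P.image i, ?_, ?_⟩ : T))
        · rw [Finset.sum_image hinj, Finset.card_eq_sum_ones, Nat.cast_sum]
          refine Finset.sum_le_sum fun p hp => ?_
          rw [indicator_of_mem]
          · simp
          · exact ⟨p, (hi p hp).1, (hP hp).2⟩
        · intro a ha b hb hab
          simp only [Finset.coe_image, mem_image, Finset.mem_coe] at ha hb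
          obtain ⟨p, hp, rfl⟩ := ha
          obtain ⟨q, hq, rfl⟩ := hb
          have hpq : p ≠ q := fun e => hab (by rw [e])
          exact (hVd hp hq hpq).mono ((hi p hp).2.trans inter_subset_left)
            ((hi q hq).2.trans inter_subset_left)
        · intro a ha
          obtain ⟨p, hp, rfl⟩ := Finset.mem_image.1 ha
          exact (hi p hp).2.trans inter_subset_right
      rw [Measure.count_apply (hU.measurableSet.inter hZm)]
      by_cases hfin : (U ∩ F s ⁻¹' {0}).Finite
      · have := hle hfin.toFinset (by simp)
        rwa [hfin.encard_eq_coe_toFinset_card]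
      -- With infinitely many zeros, finite subsets of every cardinality force the supremum to be
      -- infinite.
      · refine le_of_le_of_eq le_top (Eq.symm (ENNReal.eq_top_of_forall_nnreal_le fun r => ?_))
        obtain ⟨n, hn⟩ := exists_nat_ge r
        obtain ⟨P, hP, hcard⟩ := (show (U ∩ F s ⁻¹' {0}).Infinite from hfin).exists_subset_card_eq n
        refine le_trans ?_ (hle P hP)
        rw [hcard]
        exact_mod_cast hn
    · refine iSup_le fun t => ?_
      calc ∑ i ∈ t.1, {s | ∃ w ∈ rationalBall i, F s w = 0}.indicator (1 : S → ℝ≥0∞) s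
          ≤ ∑ i ∈ t.1, Measure.count (rationalBall i ∩ F s ⁻¹' {0}) := by
            refine Finset.sum_le_sum fun i _ => ?_
            by_cases h : s ∈ {s | ∃ w ∈ rationalBall i, F s w = 0}
            · rw [indicator_of_mem h, Pi.one_apply]
              obtain ⟨w, hw, h0⟩ := h
              rw [← Measure.count_singleton w]
              exact measure_mono (singleton_subset_iff.2 ⟨hw, h0⟩)
            · rw [indicator_of_notMem h]; exact zero_le
        _ = Measure.count (⋃ i ∈ t.1, (rationalBall i ∩ F s ⁻¹' {0})) := by
            rw [measure_biUnion_finset]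
            · exact fun a ha b hb hab =>
                (t.2.1 ha hb hab).mono inter_subset_left inter_subset_left
            · exact fun i _ => Metric.isClosed_closedBall.measurableSet.inter hZm
        _ ≤ _ := measure_mono (iUnion₂_subset fun i hi =>
            inter_subset_inter_left _ (t.2.2 i hi))
  simp_rw [key]
  refine Measurable.iSup fun t => Finset.measurable_sum _ fun i _ => measurable_one.indicator ?_
  exact measurableSet_exists_zero_of_isCompact hc hm (isCompact_closedBall _ _)

theorem finite_zeros_of_isCompact {h : ℂ → ℂ} (hh : Differentiable ℂ h) (h0 : ∃ w, h w ≠ 0)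
    {K : Set ℂ} (hK : IsCompact K) : (K ∩ h ⁻¹' {0}).Finite := by
  by_contra hinf
  obtain ⟨x, -, hx⟩ :=
    (show (K ∩ h ⁻¹' {0}).Infinite from hinf).exists_accPt_of_subset_isCompact hK inter_subset_left
  have hfr : ∃ᶠ z in 𝓝[≠] x, h z = 0 :=
    (accPt_iff_frequently_nhdsNE.1 hx).mono fun z hz => hz.2
  obtain ⟨w, hw⟩ := h0
  exact hw ((hh.differentiableOn.analyticOnNhd
    isOpen_univ).eqOn_zero_of_preconnected_of_frequently_eq_zero isPreconnected_univ
    (mem_univ x) hfr (mem_univ w))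

/-- The number of zeros of a random entire function in a bounded Borel set is measurable. -/
theorem measurable_count_zeros {F : S → ℂ → ℂ} (hd : ∀ s, Differentiable ℂ (F s))
    (hm : ∀ w, Measurable fun s => F s w) {A : Set ℂ} (hA : MeasurableSet A)
    (hAb : Bornology.IsBounded A) :
    Measurable fun s => Measure.count (A ∩ F s ⁻¹' {0}) := by
  classical
  obtain ⟨R, hR⟩ := hAb.subset_ball 0
  have hc : ∀ s, Continuous (F s) := fun s => (hd s).continuous
  -- Identically vanishing functions are set apart: their count on `A` is the constant `count A`,
  -- whereas all others have finitely many zeros in a ball.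
  set S₀ : Set S := {s | ∃ w, F s w ≠ 0} with hS₀
  have hS₀m : MeasurableSet S₀ := by
    have : S₀ = ⋃ n, {s | F s (TopologicalSpace.denseSeq ℂ n) ≠ 0} := by
      ext s
      simp only [hS₀, mem_ofPred_eq, mem_iUnion]
      refine ⟨fun ⟨w, hw⟩ => ?_, fun ⟨n, hn⟩ => ⟨_, hn⟩⟩
      obtain ⟨n, hn⟩ := (TopologicalSpace.denseRange_denseSeq ℂ).exists_mem_open
        ((hc s).isOpen_preimage _ isOpen_ne) ⟨w, hw⟩
      exact ⟨n, hn⟩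
    rw [this]
    exact MeasurableSet.iUnion fun n => (hm _) (measurableSet_singleton 0).compl
  have hZm : ∀ s, MeasurableSet (F s ⁻¹' {0}) := fun s =>
    (hc s).measurable (measurableSet_singleton 0)
  let ν : S → Measure ℂ := fun s =>
    if s ∈ S₀ then Measure.count.restrict (Metric.ball 0 R ∩ F s ⁻¹' {0}) else 0
  have hfin : ∀ s, IsFiniteMeasure (ν s) := by
    intro s
    by_cases hs : s ∈ S₀
    · simp only [ν, if_pos hs]
      refine ⟨?_⟩
      rw [Measure.restrict_apply_univ]
      refine Measure.count_apply_lt_top.2 ((finite_zeros_of_isCompact (hd s) hs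
        (isCompact_closedBall 0 R)).subset (inter_subset_inter_left _ Metric.ball_subset_closedBall))
    · simp only [ν, if_neg hs]; infer_instance
  have hopen : ∀ U : Set ℂ, IsOpen U → Measurable fun s => ν s U := by
    intro U hU
    have : (fun s => ν s U) = fun s => S₀.indicator
        (fun s => Measure.count ((U ∩ Metric.ball 0 R) ∩ F s ⁻¹' {0})) s := by
      ext s
      by_cases hs : s ∈ S₀
      · simp only [ν, if_pos hs, indicator_of_mem hs,
          Measure.restrict_apply hU.measurableSet, inter_assoc]
      · simp only [ν, if_neg hs, indicator_of_notMem hs, Measure.coe_zero, Pi.zero_apply]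
    rw [this]
    exact (measurable_count_zeros_of_isOpen hc hm (hU.inter Metric.isOpen_ball)).indicator hS₀m
  -- The open sets form a π-system generating the Borel sets and the measures `ν s` are finite, so
  -- measurability passes from open sets to all Borel sets.
  have hν : Measurable ν := Measurable.measure_of_isPiSystem
    BorelSpace.measurable_eq
    isPiSystem_isOpen (fun U hU => hopen U hU) (hopen univ isOpen_univ)
  have hfinal : (fun s => Measure.count (A ∩ F s ⁻¹' {0})) =
      fun s => if s ∈ S₀ then ν s A else Measure.count A := by
    ext s
    by_cases hs : s ∈ S₀
    · simp only [ν, if_pos hs, Measure.restrict_apply hA]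
      rw [← inter_assoc, inter_eq_left.2 hR]
    · have : ∀ w, F s w = 0 := by simpa [hS₀] using hs
      simp only [if_neg hs]
      congr 1
      exact inter_eq_left.2 fun w _ => this w
  rw [hfinal]
  exact Measurable.ite hS₀m ((Measure.measurable_coe hA).comp hν) measurable_const

end Counting

section Gaussian

/-! ### The circularly symmetric complex Gaussian law -/

theorem complexGaussian_eq_map (v : ℝ≥0) : complexGaussian v =
    ((gaussianReal 0 (v / 2)).prod (gaussianReal 0 (v / 2))).map measurableEquivRealProd.symm := by
  rw [complexGaussian]
  congr 1
  ext p
  apply Complex.ext <;> simp [measurableEquivRealProd_symm_apply]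

instance (v : ℝ≥0) : IsProbabilityMeasure (complexGaussian v) := by
  rw [complexGaussian_eq_map]
  exact Measure.isProbabilityMeasure_map (by fun_prop)

/-- The density of `N_ℂ(0, v)`. -/
noncomputable def complexGaussianPDF (v : ℝ) (z : ℂ) : ℝ :=
  (Real.pi * v)⁻¹ * Real.exp (-(‖z‖ ^ 2 / v))

theorem measurable_complexGaussianPDF (v : ℝ) : Measurable (complexGaussianPDF v) := by
  unfold complexGaussianPDF
  fun_prop

theorem complexGaussian_eq_withDensity {v : ℝ≥0} (hv : v ≠ 0) : complexGaussian v =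
    volume.withDensity fun z => ENNReal.ofReal (complexGaussianPDF v z) := by
  have hv2 : v / 2 ≠ 0 := by positivity
  have hv0 : (0 : ℝ) < v := by positivity
  rw [complexGaussian_eq_map, gaussianReal_of_var_ne_zero _ hv2,
    prod_withDensity (measurable_gaussianPDF _ _) (measurable_gaussianPDF _ _),
    ← Measure.volume_eq_prod]
  ext s hs
  rw [Measure.map_apply (by fun_prop) hs, withDensity_apply _ (by measurability),
    withDensity_apply _ hs, ← (volume_preserving_equiv_real_prod.symm).setLIntegral_comp_preimage hs
      (measurable_complexGaussianPDF v).ennreal_ofReal]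
  refine lintegral_congr fun p => ?_
  rw [gaussianPDF, gaussianPDF, ← ENNReal.ofReal_mul (gaussianPDFReal_nonneg _ _ _)]
  congr 1
  simp only [gaussianPDFReal, complexGaussianPDF, measurableEquivRealProd_symm_apply,
    Complex.sq_norm, normSq_mk, NNReal.coe_div, NNReal.coe_ofNat, sub_zero]
  have h1 : 2 * Real.pi * ((v : ℝ) / 2) = Real.pi * v := by ring
  have h2 : 2 * ((v : ℝ) / 2) = v := by ring
  rw [h1, h2, mul_mul_mul_comm, ← Real.exp_add, ← mul_inv,
    Real.mul_self_sqrt (by positivity)]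
  congr 2
  ring

theorem lintegral_sq_norm_complexGaussian (v : ℝ≥0) (c α : ℂ) :
    ∫⁻ z, ENNReal.ofReal (‖c + α * z‖ ^ 2) ∂complexGaussian v =
      ENNReal.ofReal (‖c‖ ^ 2 + ‖α‖ ^ 2 * v) := by
  set g := gaussianReal 0 (v / 2) with hg
  have hL2 : MemLp id 2 g := memLp_id_gaussianReal 2
  have i1 : Integrable (fun x : ℝ => x) g := hL2.integrable (by norm_num)
  have i2 : Integrable (fun x : ℝ => x ^ 2) g := hL2.integrable_sq
  have e1 : ∫ x, x ∂g = 0 := integral_id_gaussianReal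
  have e2 : ∫ x, x ^ 2 ∂g = v / 2 := by
    have h1 : Var[id; g] = ((v / 2 : ℝ≥0) : ℝ) := variance_id_gaussianReal
    rw [variance_eq_sub hL2] at h1
    simpa [e1] using h1
  have hexp : ∀ p : ℝ × ℝ, ‖c + α * measurableEquivRealProd.symm p‖ ^ 2 =
      ‖c‖ ^ 2 + ‖α‖ ^ 2 * (p.1 ^ 2 + p.2 ^ 2) + (2 * (c.re * α.re + c.im * α.im)) * p.1 +
        (2 * (c.im * α.re - c.re * α.im)) * p.2 := by
    intro p
    simp only [measurableEquivRealProd_symm_apply, Complex.sq_norm, normSq_apply, add_re, add_im,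
      mul_re, mul_im]
    ring
  have f1 : Integrable (fun p : ℝ × ℝ => p.1) (g.prod g) := i1.comp_fst g
  have f2 : Integrable (fun p : ℝ × ℝ => p.2) (g.prod g) := i1.comp_snd g
  have f3 : Integrable (fun p : ℝ × ℝ => p.1 ^ 2) (g.prod g) := i2.comp_fst g
  have f4 : Integrable (fun p : ℝ × ℝ => p.2 ^ 2) (g.prod g) := i2.comp_snd g
  have f34 : Integrable (fun p : ℝ × ℝ => p.1 ^ 2 + p.2 ^ 2) (g.prod g) := f3.add f4
  have f5 : Integrable (fun p : ℝ × ℝ => ‖c‖ ^ 2 + ‖α‖ ^ 2 * (p.1 ^ 2 + p.2 ^ 2)) (g.prod g) :=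
    (integrable_const (μ := g.prod g) (‖c‖ ^ 2)).add (f34.const_mul (‖α‖ ^ 2))
  have f6 : Integrable (fun p : ℝ × ℝ => ‖c‖ ^ 2 + ‖α‖ ^ 2 * (p.1 ^ 2 + p.2 ^ 2) +
      (2 * (c.re * α.re + c.im * α.im)) * p.1) (g.prod g) :=
    f5.add (f1.const_mul (2 * (c.re * α.re + c.im * α.im)))
  have f7 : Integrable (fun p : ℝ × ℝ => ‖c‖ ^ 2 + ‖α‖ ^ 2 * (p.1 ^ 2 + p.2 ^ 2) +
      (2 * (c.re * α.re + c.im * α.im)) * p.1 + (2 * (c.im * α.re - c.re * α.im)) * p.2)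
      (g.prod g) :=
    f6.add (f2.const_mul (2 * (c.im * α.re - c.re * α.im)))
  have I1 : ∫ p : ℝ × ℝ, p.1 ∂(g.prod g) = 0 := by
    rw [integral_fun_fst (fun x : ℝ => x)]; simp [e1]
  have I2 : ∫ p : ℝ × ℝ, p.2 ∂(g.prod g) = 0 := by
    rw [integral_fun_snd (fun x : ℝ => x)]; simp [e1]
  have I3 : ∫ p : ℝ × ℝ, p.1 ^ 2 ∂(g.prod g) = v / 2 := by
    rw [integral_fun_fst (fun x : ℝ => x ^ 2)]; simp [e2]
  have I4 : ∫ p : ℝ × ℝ, p.2 ^ 2 ∂(g.prod g) = v / 2 := by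
    rw [integral_fun_snd (fun x : ℝ => x ^ 2)]; simp [e2]
  rw [complexGaussian_eq_map, lintegral_map (by fun_prop) (by fun_prop),
    ← ofReal_integral_eq_lintegral_ofReal]
  · congr 1
    simp_rw [hexp]
    rw [integral_add f6 (f2.const_mul _), integral_add f5 (f1.const_mul _),
      integral_add (integrable_const _) (f34.const_mul _), integral_const_mul,
      integral_const_mul, integral_const_mul, integral_add f3 f4, I1, I2, I3, I4]
    simp
  · simp_rw [hexp]
    exact f7
  · exact Filter.Eventually.of_forall fun p => by positivity

theorem integral_cexp_re_complexGaussian (v : ℝ≥0) :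
    ∫ z, cexp (z.re * I) ∂complexGaussian v = cexp (-(((v : ℝ) : ℂ) / 4)) := by
  rw [complexGaussian_eq_map, integral_map_equiv]
  have h := integral_fun_fst (μ := gaussianReal 0 (v / 2)) (ν := gaussianReal 0 (v / 2))
    (fun x : ℝ => cexp (x * I))
  simp only [measurableEquivRealProd_symm_apply] at h ⊢
  rw [h]
  have h1 := charFun_gaussianReal (μ := 0) (v := v / 2) 1
  rw [charFun_apply] at h1
  simp only [RCLike.inner_apply, conj_trivial, one_mul] at h1
  rw [h1]
  simp only [probReal_univ, one_smul]
  congr 1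
  simp only [NNReal.coe_div, NNReal.coe_ofNat, ofReal_div, ofReal_ofNat, ofReal_one, ofReal_zero]
  ring

/-- Completing the square, the density of `N_ℂ(0, v)` times the standard density at `p + m` is a
constant times the density of a complex Gaussian with mean `-m v/(1+v)` and variance `v/(1+v)`. What
remains is a second moment under that law. -/
theorem lintegral_exp_neg_mul_complexGaussian {v : ℝ≥0} (hv : v ≠ 0) (m α β : ℂ) {s : ℝ}
    (hs : 0 ≤ s) :
    ∫⁻ p, ENNReal.ofReal (Real.pi⁻¹ * Real.exp (-‖p + m‖ ^ 2) * (‖α * p + β‖ ^ 2 + s))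
        ∂complexGaussian v =
      ENNReal.ofReal ((Real.pi * (1 + v))⁻¹ * Real.exp (-(‖m‖ ^ 2 / (1 + v))) *
        (‖β - α * m * (v / (1 + v))‖ ^ 2 + ‖α‖ ^ 2 * (v / (1 + v)) + s)) := by
  have hv0 : (0 : ℝ) < v := by positivity
  set K : ℝ := 1 + v with hK
  have hK0 : 0 < K := by positivity
  set v' : ℝ≥0 := v / (1 + v) with hv'
  have hv'0 : v' ≠ 0 := by positivity
  have hv'c : (v' : ℝ) = v / K := by simp [hv', hK]
  set p₀ : ℂ := -(m * (v / K : ℝ)) with hp₀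
  set C : ℝ := (Real.pi * K)⁻¹ * Real.exp (-(‖m‖ ^ 2 / K)) with hC
  have hC0 : 0 ≤ C := by positivity
  have hdens : ∀ y : ℂ, complexGaussianPDF v (p₀ + y) *
      (Real.pi⁻¹ * Real.exp (-‖p₀ + y + m‖ ^ 2)) = C * complexGaussianPDF v' y := by
    intro y
    have hexp : ‖p₀ + y‖ ^ 2 / v + ‖p₀ + y + m‖ ^ 2 = ‖m‖ ^ 2 / K + ‖y‖ ^ 2 / (v / K) := by
      simp only [hp₀, Complex.sq_norm, normSq_apply, add_re, add_im, neg_re, neg_im, re_mul_ofReal,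
        im_mul_ofReal]
      field_simp
      rw [hK]
      ring
    simp only [complexGaussianPDF, hC, hv'c]
    have hE : Real.exp (-(‖p₀ + y‖ ^ 2 / v)) * Real.exp (-‖p₀ + y + m‖ ^ 2) =
        Real.exp (-(‖m‖ ^ 2 / K)) * Real.exp (-(‖y‖ ^ 2 / (v / K))) := by
      rw [← Real.exp_add, ← Real.exp_add]
      congr 1
      linarith
    rw [mul_mul_mul_comm, hE, mul_mul_mul_comm (Real.pi * K)⁻¹]
    congr 1
    field_simp
  rw [complexGaussian_eq_withDensity hv, lintegral_withDensity_eq_lintegral_mul _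
    (measurable_complexGaussianPDF v).ennreal_ofReal (by fun_prop)]
  rw [← lintegral_add_left_eq_self _ p₀]
  have hpt : ∀ y : ℂ, ((fun z => ENNReal.ofReal (complexGaussianPDF v z)) * fun p =>
      ENNReal.ofReal (Real.pi⁻¹ * Real.exp (-‖p + m‖ ^ 2) * (‖α * p + β‖ ^ 2 + s))) (p₀ + y) =
      ENNReal.ofReal C * (ENNReal.ofReal (complexGaussianPDF v' y) *
        (ENNReal.ofReal (‖(β + α * p₀) + α * y‖ ^ 2) + ENNReal.ofReal s)) := by
    intro y
    have hpos : ∀ (u : ℝ≥0) z, 0 ≤ complexGaussianPDF u z := fun u z => by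
      unfold complexGaussianPDF; positivity
    rw [Pi.mul_apply, ← ENNReal.ofReal_mul (hpos _ _), ← mul_assoc (complexGaussianPDF v (p₀ + y)),
      hdens, ← ENNReal.ofReal_add (by positivity) hs, ← ENNReal.ofReal_mul (hpos _ _),
      ← ENNReal.ofReal_mul hC0]
    congr 1
    rw [show α * (p₀ + y) + β = (β + α * p₀) + α * y by ring]
    ring
  simp_rw [hpt]
  rw [lintegral_const_mul _ (by have := measurable_complexGaussianPDF v'; fun_prop),
    ← Pi.mul_def (fun y => ENNReal.ofReal (complexGaussianPDF v' y))
      (fun y => ENNReal.ofReal (‖(β + α * p₀) + α * y‖ ^ 2) + ENNReal.ofReal s),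
    ← lintegral_withDensity_eq_lintegral_mul _
    (measurable_complexGaussianPDF v').ennreal_ofReal (by fun_prop),
    ← complexGaussian_eq_withDensity hv'0, lintegral_add_right _ measurable_const,
    lintegral_sq_norm_complexGaussian, lintegral_const, measure_univ, mul_one,
    ← ENNReal.ofReal_add (by positivity) hs, ← ENNReal.ofReal_mul hC0, hv'c]
  congr 5
  rw [hp₀, hK]
  push_cast
  ring_nf

end Gaussian

/-! ### Kac–Rice formula by conditioning on an independent Gaussian constant term. -/

section KacRice

variable {Ω : Type*} [MeasurableSpace Ω] {μ : Measure Ω} [IsProbabilityMeasure μ]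

/-- Kac–Rice formula for `ζ + f`, where `f` is a random entire function and `ζ` an independent
standard complex Gaussian variable. -/
theorem lintegral_count_zeros {Ω' : Type*} [MeasurableSpace Ω'] {ζ : Ω → ℂ} {T : Ω → Ω'}
    (hζ : Measurable ζ) (hT : Measurable T) (hind : IndepFun ζ T μ)
    (hlaw : μ.map ζ = complexGaussian 1) {f : Ω' → ℂ → ℂ} (hd : ∀ s, Differentiable ℂ (f s))
    (hm : ∀ w, Measurable fun s => f s w) (hm' : ∀ w, Measurable fun s => deriv (f s) w)
    {A : Set ℂ} (hA : MeasurableSet A) (hAb : Bornology.IsBounded A) :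
    ∫⁻ ω, Measure.count (A ∩ (fun w => ζ ω + f (T ω) w) ⁻¹' {0}) ∂μ =
      ∫⁻ w in A, ∫⁻ ω, ENNReal.ofReal
        (Real.pi⁻¹ * Real.exp (-‖f (T ω) w‖ ^ 2) * ‖deriv (f (T ω)) w‖ ^ 2) ∂μ := by
  have hΦ : Measurable fun p : ℂ × Ω' =>
      Measure.count (A ∩ (fun w => p.1 + f p.2 w) ⁻¹' {0}) :=
    measurable_count_zeros (S := ℂ × Ω') (F := fun p w => p.1 + f p.2 w)
      (fun p => (differentiable_const p.1).add (hd p.2))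
      (fun w => measurable_fst.add ((hm w).comp measurable_snd)) hA hAb
  have hinner : ∀ s, ∫⁻ u, Measure.count (A ∩ (fun w => u + f s w) ⁻¹' {0}) ∂complexGaussian 1 =
      ∫⁻ w in A, ENNReal.ofReal
        (Real.pi⁻¹ * Real.exp (-‖f s w‖ ^ 2) * ‖deriv (f s) w‖ ^ 2) := by
    intro s
    have hms : Measurable fun u => Measure.count (A ∩ (fun w => u + f s w) ⁻¹' {0}) :=
      measurable_count_zeros (S := ℂ) (F := fun u w => u + f s w)
        (fun u => (differentiable_const u).add (hd s))
        (fun w => measurable_id.add measurable_const) hA hAb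
    rw [complexGaussian_eq_withDensity one_ne_zero, lintegral_withDensity_eq_lintegral_mul _
      (measurable_complexGaussianPDF _).ennreal_ofReal hms]
    -- The zeros of `u + f s` form the fibre of `-f s` over `u`, so the area formula applies with
    -- the Gaussian density as weight.
    have := lintegral_count_fiber (hd s).neg hA
      (measurable_complexGaussianPDF (1 : ℝ≥0)).ennreal_ofReal
    simp only [Pi.mul_apply]
    refine Eq.trans (lintegral_congr fun u => ?_) (this.trans (lintegral_congr fun w => ?_))
    · congr 3
      ext w
      simp only [Set.mem_preimage, Set.mem_singleton_iff, Pi.neg_apply]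
      rw [neg_eq_iff_add_eq_zero, add_comm]
    · rw [deriv.neg, norm_neg, ← ENNReal.ofReal_mul (by positivity)]
      congr 1
      simp [complexGaussianPDF]
      ring
  -- Continuity in `w` and measurability in `s` give joint measurability, needed to exchange the
  -- integrals.
  have hjoint : Measurable (Function.uncurry fun (w : ℂ) (s : Ω') => f s w) :=
    measurable_uncurry_of_continuous_of_measurable (fun s => (hd s).continuous) hm
  have hjoint' : Measurable (Function.uncurry fun (w : ℂ) (s : Ω') => deriv (f s) w) :=
    measurable_uncurry_of_continuous_of_measurable
      (fun s => ((hd s).contDiff (n := 1)).continuous_deriv le_rfl) hm'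
  have hmeas : Measurable (Function.uncurry fun (w : ℂ) (s : Ω') => ENNReal.ofReal
      (Real.pi⁻¹ * Real.exp (-‖f s w‖ ^ 2) * ‖deriv (f s) w‖ ^ 2)) := by
    have h1 : Measurable fun p : ℂ × Ω' => f p.2 p.1 := hjoint
    have h2 : Measurable fun p : ℂ × Ω' => deriv (f p.2) p.1 := hjoint'
    exact ((measurable_const.mul (Real.measurable_exp.comp (h1.norm.pow_const 2).neg)).mul
      (h2.norm.pow_const 2)).ennreal_ofReal
  have hprob : IsProbabilityMeasure (μ.map T) := Measure.isProbabilityMeasure_map hT.aemeasurable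
  calc _ = ∫⁻ p, Measure.count (A ∩ (fun w => p.1 + f p.2 w) ⁻¹' {0})
        ∂(μ.map fun ω => (ζ ω, T ω)) := (lintegral_map hΦ (hζ.prodMk hT)).symm
    _ = ∫⁻ s, ∫⁻ u, Measure.count (A ∩ (fun w => u + f s w) ⁻¹' {0})
        ∂complexGaussian 1 ∂(μ.map T) := by
      rw [hind.map_prod_eq_prod_map_map hζ.aemeasurable hT.aemeasurable, hlaw,
        lintegral_prod_symm' _ hΦ]
    _ = ∫⁻ s, (∫⁻ w in A, ENNReal.ofReal
        (Real.pi⁻¹ * Real.exp (-‖f s w‖ ^ 2) * ‖deriv (f s) w‖ ^ 2)) ∂(μ.map T) := by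
      simp_rw [hinner]
    _ = ∫⁻ w in A, ∫⁻ s, ENNReal.ofReal
        (Real.pi⁻¹ * Real.exp (-‖f s w‖ ^ 2) * ‖deriv (f s) w‖ ^ 2) ∂(μ.map T) :=
      lintegral_lintegral_swap (hmeas.comp measurable_swap).aemeasurable
    _ = _ := by
      refine lintegral_congr fun w => lintegral_map ?_ hT
      exact ((measurable_const.mul (Real.measurable_exp.comp ((hm w).norm.pow_const 2).neg)).mul
        ((hm' w).norm.pow_const 2)).ennreal_ofReal

end KacRice

/-! ### Joint laws and independence for white noise. -/

section WhiteNoise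

variable {Ω : Type*} [MeasurableSpace Ω] {μ : Measure Ω} {ξ : Ω → 𝓢'(ℝ, ℂ)}

/-- The embedding of Schwartz functions in `L²`. -/
noncomputable abbrev toL2 : 𝓢(ℝ, ℂ) →L[ℂ] Lp ℂ 2 (volume : Measure ℝ) :=
  SchwartzMap.toLpCLM ℂ ℂ 2 volume

theorem inner_toL2 (φ ψ : 𝓢(ℝ, ℂ)) :
    inner ℂ (toL2 φ) (toL2 ψ) = ∫ t, ψ t * (starRingEnd ℂ) (φ t) :=
  SchwartzMap.inner_toL2_toL2_eq φ ψ

theorem norm_toL2_sq (φ : 𝓢(ℝ, ℂ)) : ‖toL2 φ‖ ^ 2 = ∫ t, ‖φ t‖ ^ 2 := by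
  have h : ((‖toL2 φ‖ ^ 2 : ℝ) : ℂ) = ((∫ t, ‖φ t‖ ^ 2 : ℝ) : ℂ) := by
    rw [ofReal_pow, ← RCLike.ofReal_eq_complex_ofReal, ← inner_self_eq_norm_sq_to_K (𝕜 := ℂ),
      inner_toL2, ← integral_ofReal]
    refine integral_congr_ae (.of_forall fun t => ?_)
    simp [Complex.mul_conj']
  exact_mod_cast h

theorem IsComplexWhiteNoise.map_eq (hξ : IsComplexWhiteNoise μ ξ) (φ : 𝓢(ℝ, ℂ)) :
    μ.map (fun ω => ξ ω φ) = complexGaussian (‖toL2 φ‖₊ ^ 2) := by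
  rw [hξ.law, ← norm_toL2_sq]
  congr 1
  rw [Real.toNNReal_pow (norm_nonneg _), norm_toNNReal]

theorem IsComplexWhiteNoise.integral_cexp (hξ : IsComplexWhiteNoise μ ξ) (φ : 𝓢(ℝ, ℂ)) :
    ∫ ω, cexp ((ξ ω φ).re * I) ∂μ = cexp (-(‖toL2 φ‖ ^ 2 / 4)) := by
  rw [← integral_map (φ := fun ω => ξ ω φ) (f := fun z : ℂ => cexp (z.re * I))
    (hξ.measurable φ).aemeasurable (by fun_prop), hξ.map_eq, integral_cexp_re_complexGaussian]
  simp

theorem exists_eq_re_mul (l : ℂ →L[ℝ] ℝ) : ∃ c : ℂ, ∀ z, l z = (c * z).re := by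
  refine ⟨⟨l 1, -l I⟩, fun z => ?_⟩
  have : z = z.re • (1 : ℂ) + z.im • I := by simp
  conv_lhs => rw [this, map_add, map_smul, map_smul]
  simp
  ring

/-- A real functional of finitely many noise values is the real part of the noise at one test
function. Hence the one-dimensional laws in the definition of white noise determine all joint
characteristic functions. -/
theorem exists_dual_eq_re {ι : Type*} [Fintype ι] (ψ : ι → 𝓢(ℝ, ℂ)) (l : (ι → ℂ) →L[ℝ] ℝ) :
    ∃ φ ∈ Submodule.span ℂ (Set.range ψ), ∀ y : 𝓢'(ℝ, ℂ), l (fun i => y (ψ i)) = (y φ).re := by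
  classical
  have : ∀ i, ∃ c : ℂ, ∀ z, l (Pi.single i z) = (c * z).re :=
    fun i => exists_eq_re_mul (l.comp (ContinuousLinearMap.single ℝ (fun _ : ι => ℂ) i))
  choose d hd using this
  refine ⟨∑ i, d i • ψ i, Submodule.sum_mem _ fun i _ => Submodule.smul_mem _ _
    (Submodule.subset_span ⟨i, rfl⟩), fun y => ?_⟩
  have h1 : y (∑ i, d i • ψ i) = ∑ i, d i * y (ψ i) := by
    rw [map_sum y]
    exact Finset.sum_congr rfl fun i _ => by rw [map_smul y, smul_eq_mul]
  have h2 : ∀ x : ι → ℂ, l x = ∑ i, l (Pi.single i (x i)) := fun x => by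
    rw [← map_sum, Finset.univ_sum_single]
  refine (h2 _).trans (Eq.trans ?_ (congrArg re h1).symm)
  rw [re_sum]
  exact Finset.sum_congr rfl fun i _ => hd i _

theorem apply_prodMk {E F : Type*} [NormedAddCommGroup E] [NormedSpace ℝ E]
    [NormedAddCommGroup F] [NormedSpace ℝ F] (l : E × F →L[ℝ] ℝ) (x : E) (y : F) :
    l (x, y) = (l.comp (.inl ℝ E F)) x + (l.comp (.inr ℝ E F)) y := by
  rw [ContinuousLinearMap.comp_apply, ContinuousLinearMap.comp_apply, ← map_add]
  simp

theorem IsComplexWhiteNoise.charFunDual_eq (hξ : IsComplexWhiteNoise μ ξ) {E : Type*}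
    [NormedAddCommGroup E] [NormedSpace ℝ E] [MeasurableSpace E] [BorelSpace E]
    [SecondCountableTopology E] {X : Ω → E} (hX : Measurable X) (l : StrongDual ℝ E)
    (χ : 𝓢(ℝ, ℂ)) (h : ∀ ω, l (X ω) = (ξ ω χ).re) :
    charFunDual (μ.map X) l = cexp (-(‖toL2 χ‖ ^ 2 / 4)) := by
  have hc : Continuous fun v => cexp (((l v : ℝ) : ℂ) * I) :=
    ((ofRealCLM.continuous.comp l.continuous).mul continuous_const).cexp
  rw [charFunDual_apply, integral_map hX.aemeasurable hc.aestronglyMeasurable,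
    ← hξ.integral_cexp]
  exact integral_congr_ae (.of_forall fun ω => by simp only [h])

variable [IsProbabilityMeasure μ]

/-- Values of the noise at test functions orthogonal to `ψ` are independent of its value at `ψ`. -/
theorem IsComplexWhiteNoise.indepFun (hξ : IsComplexWhiteNoise μ ξ) (ψ : 𝓢(ℝ, ℂ)) :
    IndepFun (fun ω => ξ ω ψ)
      (fun ω (φ : {φ : 𝓢(ℝ, ℂ) // inner ℂ (toL2 ψ) (toL2 φ) = 0}) => ξ ω φ) μ := by
  -- Independence from the whole family reduces to finite subfamilies, where it amounts to
  -- factorisation of the characteristic function.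
  refine IndepFun.indepFun_process (hξ.measurable ψ) (fun φ => hξ.measurable φ) fun J => ?_
  have hY : Measurable fun ω (i : J) => ξ ω i.1.1 :=
    measurable_pi_lambda _ fun i => hξ.measurable _
  rw [indepFun_iff_charFunDual_prod (hξ.measurable ψ).aemeasurable hY.aemeasurable]
  intro l
  obtain ⟨c, hc⟩ := exists_eq_re_mul (l.comp (.inl ℝ ℂ (J → ℂ)))
  obtain ⟨φ, hφ, e2⟩ := exists_dual_eq_re (fun i : J => i.1.1) (l.comp (.inr ℝ ℂ (J → ℂ)))
  have e1 : ∀ ω, (l.comp (.inl ℝ ℂ (J → ℂ))) (ξ ω ψ) = (ξ ω (c • ψ)).re := fun ω => by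
    rw [hc, map_smul (ξ ω), smul_eq_mul]
  have e3 : ∀ ω, l (ξ ω ψ, fun i : J => ξ ω i.1.1) = (ξ ω (c • ψ + φ)).re := fun ω => by
    have h : ξ ω (c • ψ + φ) = ξ ω (c • ψ) + ξ ω φ := map_add (ξ ω) _ _
    refine (apply_prodMk l _ _).trans (Eq.trans ?_ (congrArg re h).symm)
    exact congrArg₂ (fun x y : ℝ => x + y) (e1 ω) (e2 (ξ ω))
  have horth : inner ℂ (toL2 ψ) (toL2 φ) = 0 := by
    refine Submodule.span_induction (p := fun φ _ => inner ℂ (toL2 ψ) (toL2 φ) = 0) ?_ ?_ ?_ ?_ hφ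
    · rintro _ ⟨i, rfl⟩
      exact i.1.2
    · rw [map_zero, inner_zero_right]
    · intro x y _ _ hx hy
      rw [map_add, inner_add_right, hx, hy, add_zero]
    · intro a x _ hx
      rw [map_smul, inner_smul_right, hx, mul_zero]
  have horth' : inner ℂ (toL2 (c • ψ)) (toL2 φ) = 0 := by
    rw [map_smul, inner_smul_left, horth, mul_zero]
  -- Pythagoras makes the Gaussian exponents add, which is the required factorisation.
  have hpyth : ‖toL2 (c • ψ + φ)‖ ^ 2 = ‖toL2 (c • ψ)‖ ^ 2 + ‖toL2 φ‖ ^ 2 := by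
    rw [map_add, sq, norm_add_sq_eq_norm_sq_add_norm_sq_of_inner_eq_zero _ _ horth', sq, sq]
  have hpyth' := congrArg (fun x : ℝ => (x : ℂ)) hpyth
  push_cast at hpyth'
  refine (hξ.charFunDual_eq ((hξ.measurable ψ).prodMk hY) l _ e3).trans ?_
  refine Eq.trans ?_ (congrArg₂ (fun x y : ℂ => x * y)
    (hξ.charFunDual_eq (hξ.measurable ψ) _ _ e1)
    (hξ.charFunDual_eq hY _ _ fun ω => e2 (ξ ω))).symm
  rw [← Complex.exp_add, hpyth']
  congr 1
  ring

theorem IsComplexWhiteNoise.indepFun_of_inner_eq_zero (hξ : IsComplexWhiteNoise μ ξ)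
    {ψ φ : 𝓢(ℝ, ℂ)} (h : inner ℂ (toL2 ψ) (toL2 φ) = 0) :
    IndepFun (fun ω => ξ ω ψ) (fun ω => ξ ω φ) μ :=
  (hξ.indepFun ψ).comp measurable_id
    (measurable_pi_apply (⟨φ, h⟩ : {φ : 𝓢(ℝ, ℂ) // inner ℂ (toL2 ψ) (toL2 φ) = 0}))

/-- Expectation of `e^{-|X|²} |Y|²` for jointly Gaussian `X = ξ(φ) + m` and `Y = ξ(ψ) + β`. -/
theorem IsComplexWhiteNoise.lintegral_exp_neg_mul (hξ : IsComplexWhiteNoise μ ξ)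
    {φ ψ : 𝓢(ℝ, ℂ)} (hφ : toL2 φ ≠ 0) (m β : ℂ) :
    ∫⁻ ω, ENNReal.ofReal (Real.pi⁻¹ * Real.exp (-‖ξ ω φ + m‖ ^ 2) * ‖ξ ω ψ + β‖ ^ 2) ∂μ =
      ENNReal.ofReal ((Real.pi * (1 + ‖toL2 φ‖ ^ 2))⁻¹ *
        Real.exp (-(‖m‖ ^ 2 / (1 + ‖toL2 φ‖ ^ 2))) *
        (‖β - inner ℂ (toL2 φ) (toL2 ψ) * m / (1 + ‖toL2 φ‖ ^ 2)‖ ^ 2 + ‖toL2 ψ‖ ^ 2 -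
          ‖inner ℂ (toL2 φ) (toL2 ψ)‖ ^ 2 / (1 + ‖toL2 φ‖ ^ 2))) := by
  set c : ℂ := inner ℂ (toL2 φ) (toL2 ψ) with hc
  set v : ℝ≥0 := ‖toL2 φ‖₊ ^ 2 with hv
  have hvr : (v : ℝ) = ‖toL2 φ‖ ^ 2 := by simp [hv]
  have hv0 : v ≠ 0 := by
    rw [hv]; exact pow_ne_zero _ (nnnorm_ne_zero_iff.2 hφ)
  have hvpos : (0 : ℝ) < v := by positivity
  set α : ℂ := c / v with hα
  -- Gaussian regression: `η` is the part of `ψ` orthogonal to `φ`, so `ξ(η)` is independent of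
  -- `ξ(φ)`.
  set η : 𝓢(ℝ, ℂ) := ψ - α • φ with hη
  have hvc : (v : ℂ) = ((‖toL2 φ‖ : ℝ) : ℂ) ^ 2 := by rw [← ofReal_pow, ← hvr]
  have hvc0 : (v : ℂ) ≠ 0 := by exact_mod_cast hv0
  have hself : inner ℂ (toL2 φ) (toL2 φ) = (v : ℂ) := by
    rw [inner_self_eq_norm_sq_to_K, hvc]; rfl
  have horth : inner ℂ (toL2 φ) (toL2 η) = 0 := by
    rw [hη, map_sub, map_smul, inner_sub_right, inner_smul_right, hself, ← hc, hα]
    field_simp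
    simp
  have hψ : toL2 ψ = α • toL2 φ + toL2 η := by rw [hη, map_sub, map_smul]; abel
  have hηn : ‖toL2 ψ‖ ^ 2 = ‖c‖ ^ 2 / v + ‖toL2 η‖ ^ 2 := by
    rw [hψ, sq, norm_add_sq_eq_norm_sq_add_norm_sq_of_inner_eq_zero _ _
      (by rw [inner_smul_left, horth, mul_zero]), ← sq, ← sq, norm_smul, mul_pow, ← hvr, hα,
      norm_div]
    have : ‖(v : ℂ)‖ = v := by simp
    rw [this]
    field_simp
  set s : ℝ≥0 := ‖toL2 η‖₊ ^ 2 with hs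
  have hsr : (s : ℝ) = ‖toL2 η‖ ^ 2 := by simp [hs]
  have hind := hξ.indepFun_of_inner_eq_zero horth
  have hm1 := hξ.measurable φ
  have hm2 := hξ.measurable η
  have step : ∫⁻ ω, ENNReal.ofReal
      (Real.pi⁻¹ * Real.exp (-‖ξ ω φ + m‖ ^ 2) * ‖ξ ω ψ + β‖ ^ 2) ∂μ =
      ∫⁻ p, ∫⁻ q, ENNReal.ofReal (Real.pi⁻¹ * Real.exp (-‖p + m‖ ^ 2) *
        ‖(α * p + β) + 1 * q‖ ^ 2) ∂complexGaussian s ∂complexGaussian v := by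
    rw [← hξ.map_eq φ, ← hξ.map_eq η, ← lintegral_prod (fun x : ℂ × ℂ => ENNReal.ofReal
      (Real.pi⁻¹ * Real.exp (-‖x.1 + m‖ ^ 2) * ‖(α * x.1 + β) + 1 * x.2‖ ^ 2))
      (by fun_prop), ← hind.map_prod_eq_prod_map_map hm1.aemeasurable hm2.aemeasurable,
      lintegral_map (by fun_prop) (hm1.prodMk hm2)]
    refine lintegral_congr fun ω => ?_
    have : ξ ω ψ = α * ξ ω φ + ξ ω η := by
      rw [hη, map_sub, map_smul, smul_eq_mul]; ring
    rw [this]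
    ring_nf
  have inner_step : ∀ p : ℂ, ∫⁻ q, ENNReal.ofReal (Real.pi⁻¹ * Real.exp (-‖p + m‖ ^ 2) *
        ‖(α * p + β) + 1 * q‖ ^ 2) ∂complexGaussian s =
      ENNReal.ofReal (Real.pi⁻¹ * Real.exp (-‖p + m‖ ^ 2) * (‖α * p + β‖ ^ 2 + s)) := by
    intro p
    have h0 : 0 ≤ Real.pi⁻¹ * Real.exp (-‖p + m‖ ^ 2) := by positivity
    simp_rw [ENNReal.ofReal_mul h0]
    rw [lintegral_const_mul _ (by fun_prop), lintegral_sq_norm_complexGaussian]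
    simp
  rw [step]
  simp_rw [inner_step]
  rw [lintegral_exp_neg_mul_complexGaussian hv0 m α β s.coe_nonneg, ← hvr]
  congr 2
  have hα' : α * m * ((v : ℂ) / (1 + (v : ℂ))) = c * m / (1 + (v : ℂ)) := by
    rw [hα]; field_simp
  have hvc' : (((v : ℝ) : ℂ)) = (v : ℂ) := rfl
  have hαn : ‖α‖ = ‖c‖ / v := by
    rw [hα, norm_div]; simp
  have hK : (1 : ℂ) + (((‖toL2 φ‖ : ℝ) : ℂ)) ^ 2 = 1 + v := by rw [hvc]
  rw [hηn, ← hsr, hK, ← hα', hαn]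
  field_simp
  ring

end WhiteNoise

/-! ### Holomorphy of the Bargmann transform of a tempered distribution. -/

section Bargmann

open Filter Topology

/-! ### Restrictions of entire functions to the real line -/

theorem iteratedDeriv_comp_ofReal {Φ : ℂ → ℂ} (hΦ : Differentiable ℂ Φ) (n : ℕ) :
    iteratedDeriv n (fun t : ℝ => Φ t) = fun t : ℝ => iteratedDeriv n Φ t := by
  induction n with
  | zero => simp
  | succ n ih =>
    ext t
    rw [iteratedDeriv_succ, ih, iteratedDeriv_succ]
    have h : Differentiable ℂ (iteratedDeriv n Φ) :=
      (hΦ.contDiff (n := ⊤)).differentiable_iteratedDeriv n (by exact_mod_cast WithTop.coe_lt_top _)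
    exact ((h t).hasDerivAt.comp_ofReal).deriv

/-- Cauchy's estimate on the unit circle: a pointwise bound near the real line controls every
derivative, so Schwartz seminorms need no explicit differentiation. -/
theorem norm_iteratedFDeriv_comp_ofReal_le {Φ : ℂ → ℂ} (hΦ : Differentiable ℂ Φ) (n : ℕ) (t : ℝ)
    {B : ℝ} (hB : ∀ s : ℂ, ‖s - t‖ = 1 → ‖Φ s‖ ≤ B) :
    ‖iteratedFDeriv ℝ n (fun t : ℝ => Φ t) t‖ ≤ n.factorial * B := by
  rw [norm_iteratedFDeriv_eq_norm_iteratedDeriv, iteratedDeriv_comp_ofReal hΦ]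
  have := norm_iteratedDeriv_le_of_forall_mem_sphere_norm_le (c := (t : ℂ)) (R := 1) n one_pos
    hΦ.diffContOnCl (fun z hz => hB z (by simpa [dist_eq_norm] using hz))
  simpa using this

/-! ### Gaussian generating functions -/

/-- `t ↦ 2^{1/4} e^{-πt² + 2πtw}`, as a Schwartz function. -/
noncomputable def genSchwartz (w : ℂ) : 𝓢(ℝ, ℂ) :=
  cexp (Real.pi * w.re ^ 2) • atom ((starRingEnd ℂ) w)

theorem genSchwartz_apply (w : ℂ) (t : ℝ) : genSchwartz w t =
    ((2 : ℝ) ^ (1 / 4 : ℝ) : ℝ) * cexp (-Real.pi * t ^ 2 + 2 * Real.pi * t * w) := by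
  change cexp (Real.pi * w.re ^ 2) * (window (t - ((starRingEnd ℂ) w).re) *
    cexp (-2 * I * Real.pi * ((starRingEnd ℂ) w).im * t)) = _
  rw [window, ofReal_mul, ofReal_exp, mul_assoc (((2 : ℝ) ^ (1 / 4 : ℝ) : ℝ) : ℂ),
    mul_left_comm, ← Complex.exp_add, ← Complex.exp_add]
  congr 2
  conv_rhs => rw [← re_add_im w]
  simp only [conj_re, conj_im]
  push_cast
  ring

theorem hasTemperateGrowth_affine (α β : ℂ) :
    Function.HasTemperateGrowth fun t : ℝ => α * t + β :=
  ((Function.HasTemperateGrowth.const α).mul (ofRealCLM.hasTemperateGrowth)).add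
    (Function.HasTemperateGrowth.const β)

/-- `t ↦ 2πt 2^{1/4} e^{-πt² + 2πtw}`, as a Schwartz function. -/
noncomputable def genSchwartzDeriv (w : ℂ) : 𝓢(ℝ, ℂ) :=
  SchwartzMap.smulLeftCLM ℂ (fun t : ℝ => (2 * Real.pi : ℂ) * t + 0) (genSchwartz w)

theorem genSchwartzDeriv_apply (w : ℂ) (t : ℝ) :
    genSchwartzDeriv w t = 2 * Real.pi * t * genSchwartz w t := by
  rw [genSchwartzDeriv, SchwartzMap.smulLeftCLM_apply_apply (hasTemperateGrowth_affine _ _),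
    smul_eq_mul, add_zero]

/-- In the strip `|Im s| ≤ 1`, the real part of `s²` differs from `|s|²` by at most 2, so Gaussian
decay survives. -/
theorem norm_cexp_quadratic_le (w s : ℂ) (hs : |s.im| ≤ 1) :
    ‖cexp (-Real.pi * s ^ 2 + 2 * Real.pi * s * w)‖ ≤
      Real.exp (-Real.pi * ‖s‖ ^ 2 + 2 * Real.pi + 2 * Real.pi * ‖s‖ * ‖w‖) := by
  rw [norm_exp]
  gcongr
  have h1 : (2 * Real.pi * s * w).re ≤ 2 * Real.pi * ‖s‖ * ‖w‖ := by
    refine (re_le_norm _).trans (le_of_eq ?_)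
    simp [abs_of_pos Real.pi_pos]
  have h2 : (-Real.pi * s ^ 2 : ℂ).re = -Real.pi * ‖s‖ ^ 2 + 2 * Real.pi * s.im ^ 2 := by
    rw [Complex.sq_norm, normSq_apply, ← ofReal_neg, re_ofReal_mul, sq, mul_re]
    ring
  have h3 : s.im ^ 2 ≤ 1 := (sq_le_one_iff_abs_le_one _).2 hs
  rw [add_re, h2]
  nlinarith [Real.pi_pos]

/-- The remainder is the second-order Taylor remainder of `exp(2πth)` times a Gaussian, hence
quadratic in `h` in every seminorm. -/
theorem exists_seminorm_genSchwartz_sub_le (w : ℂ) (k n : ℕ) : ∃ C, ∀ h : ℂ, ‖h‖ ≤ 1 →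
    SchwartzMap.seminorm ℂ k n (genSchwartz (w + h) - genSchwartz w - h • genSchwartzDeriv w) ≤
      C * ‖h‖ ^ 2 := by
  set c₀ : ℝ := (2 : ℝ) ^ (1 / 4 : ℝ) with hc₀
  have hc₀pos : 0 < c₀ := by positivity
  have hpi := Real.pi_pos
  -- Here `a` collects the linear rates in `x = ‖s‖` of all the exponential factors, and `a²/(4π)`
  -- is the maximum of `ax - πx²`.
  set a : ℝ := 1 + 2 * Real.pi + 2 * Real.pi * ‖w‖ with ha
  set M : ℝ := c₀ * ((2 * Real.pi) ^ 2 * ((k + 2).factorial *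
    Real.exp (1 + 2 * Real.pi + a ^ 2 / (4 * Real.pi)))) with hM
  have hM0 : 0 ≤ M := by positivity
  refine ⟨n.factorial * M, fun h hh => SchwartzMap.seminorm_le_bound ℂ k n _ (by positivity)
    fun t => ?_⟩
  -- Entire extension of the remainder in the time variable, to which Cauchy's estimate applies.
  set Φ : ℂ → ℂ := fun s => c₀ * ((cexp (2 * Real.pi * s * h) - 1 - 2 * Real.pi * s * h) *
    cexp (-Real.pi * s ^ 2 + 2 * Real.pi * s * w)) with hΦ
  have hΦd : Differentiable ℂ Φ := by fun_prop
  have hcoe : ⇑(genSchwartz (w + h) - genSchwartz w - h • genSchwartzDeriv w) =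
      fun t : ℝ => Φ t := by
    ext t
    rw [sub_apply, sub_apply, smul_apply,
      genSchwartzDeriv_apply, genSchwartz_apply, genSchwartz_apply, smul_eq_mul, hΦ,
      show -(Real.pi : ℂ) * (t : ℂ) ^ 2 + 2 * Real.pi * t * (w + h) =
        2 * Real.pi * t * h + (-Real.pi * t ^ 2 + 2 * Real.pi * t * w) by ring, Complex.exp_add]
    ring
  rw [hcoe]
  have hpt : ∀ s : ℂ, ‖s - t‖ = 1 → ‖t‖ ^ k * ‖Φ s‖ ≤ M * ‖h‖ ^ 2 := by
    intro s hs
    set x : ℝ := ‖s‖ with hx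
    have hx0 : 0 ≤ x := norm_nonneg s
    have him : |s.im| ≤ 1 := by
      have := abs_im_le_norm (s - t)
      simpa [hs] using this
    have ht : ‖t‖ ≤ x + 1 := by
      have h1 : ‖(t : ℂ)‖ ≤ ‖s‖ + ‖s - t‖ := by
        have := norm_sub_le s (s - t)
        simpa using this
      rw [hs, Complex.norm_real] at h1
      exact h1
    have e1 : ‖cexp (2 * Real.pi * s * h) - 1 - 2 * Real.pi * s * h‖ ≤
        ‖h‖ ^ 2 * ((2 * Real.pi) ^ 2 * x ^ 2 * Real.exp (2 * Real.pi * x)) := by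
      have h1 := norm_exp_sub_sum_le_norm_mul_exp (2 * Real.pi * s * h) 2
      have h2 : ‖2 * (Real.pi : ℂ) * s * h‖ = 2 * Real.pi * x * ‖h‖ := by
        simp [abs_of_pos hpi, hx]
      simp only [Finset.sum_range_succ, Finset.sum_range_zero, pow_zero, pow_one,
        Nat.factorial, Nat.cast_one, div_one, zero_add, mul_one] at h1
      rw [h2, ← sub_sub] at h1
      refine h1.trans ?_
      rw [mul_pow, mul_pow]
      have : 2 * Real.pi * x * ‖h‖ ≤ 2 * Real.pi * x := mul_le_of_le_one_right (by positivity) hh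
      calc _ ≤ (2 * Real.pi) ^ 2 * x ^ 2 * ‖h‖ ^ 2 * Real.exp (2 * Real.pi * x) := by gcongr
        _ = _ := by ring
    have e2 := norm_cexp_quadratic_le w s him
    have e3 : (x + 1) ^ (k + 2) ≤ (k + 2).factorial * Real.exp (x + 1) := by
      have := Real.pow_div_factorial_le_exp (x + 1) (by positivity) (k + 2)
      rw [div_le_iff₀ (by positivity)] at this
      linarith
    have e4 : (x + 1) + 2 * Real.pi * x +
        (-Real.pi * x ^ 2 + 2 * Real.pi + 2 * Real.pi * x * ‖w‖) ≤
        1 + 2 * Real.pi + a ^ 2 / (4 * Real.pi) := by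
      have h1 : a * x - Real.pi * x ^ 2 ≤ a ^ 2 / (4 * Real.pi) := by
        rw [le_div_iff₀ (by positivity)]
        nlinarith [sq_nonneg (a - 2 * Real.pi * x)]
      rw [ha] at h1 ⊢
      linarith
    have hn : ‖Φ s‖ = c₀ * (‖cexp (2 * Real.pi * s * h) - 1 - 2 * Real.pi * s * h‖ *
        ‖cexp (-Real.pi * s ^ 2 + 2 * Real.pi * s * w)‖) := by
      rw [hΦ]
      simp only [norm_mul, Complex.norm_real, Real.norm_eq_abs, abs_of_pos hc₀pos]
    calc ‖t‖ ^ k * ‖Φ s‖ ≤ (x + 1) ^ k * (c₀ * ((‖h‖ ^ 2 * ((2 * Real.pi) ^ 2 * (x + 1) ^ 2 *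
          Real.exp (2 * Real.pi * x))) *
          Real.exp (-Real.pi * x ^ 2 + 2 * Real.pi + 2 * Real.pi * x * ‖w‖))) := by
            rw [hn]
            have : x ≤ x + 1 := by linarith
            gcongr
            refine e1.trans ?_
            gcongr
      _ = c₀ * ((2 * Real.pi) ^ 2 * ((x + 1) ^ (k + 2) * (Real.exp (2 * Real.pi * x) *
          Real.exp (-Real.pi * x ^ 2 + 2 * Real.pi + 2 * Real.pi * x * ‖w‖)))) * ‖h‖ ^ 2 := by ring
      _ ≤ c₀ * ((2 * Real.pi) ^ 2 * (((k + 2).factorial * Real.exp (x + 1)) *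
          (Real.exp (2 * Real.pi * x) *
          Real.exp (-Real.pi * x ^ 2 + 2 * Real.pi + 2 * Real.pi * x * ‖w‖)))) * ‖h‖ ^ 2 := by
            gcongr
      _ = c₀ * ((2 * Real.pi) ^ 2 * ((k + 2).factorial * Real.exp ((x + 1) + 2 * Real.pi * x +
          (-Real.pi * x ^ 2 + 2 * Real.pi + 2 * Real.pi * x * ‖w‖)))) * ‖h‖ ^ 2 := by
            rw [Real.exp_add (x + 1 + 2 * Real.pi * x), Real.exp_add (x + 1)]; ring
      _ ≤ M * ‖h‖ ^ 2 := by rw [hM]; gcongr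
  -- The weight `‖t‖ ^ k` is frozen as a constant, so differentiation does not act on it.
  have := norm_iteratedFDeriv_comp_ofReal_le (Φ := fun s => ((‖t‖ ^ k : ℝ) : ℂ) * Φ s)
    (by fun_prop) n t (B := M * ‖h‖ ^ 2) fun s hs => by
      rw [norm_mul, Complex.norm_real, Real.norm_of_nonneg (by positivity)]
      exact hpt s hs
  rw [norm_iteratedFDeriv_eq_norm_iteratedDeriv] at this ⊢
  rw [iteratedDeriv_const_mul_field, norm_mul, Complex.norm_real,
    Real.norm_of_nonneg (by positivity)] at this
  rw [mul_assoc]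
  exact this

/-- Convergence holds in the Schwartz topology, so any tempered distribution, being continuous, may
be differentiated through. -/
theorem tendsto_slope_genSchwartz (w : ℂ) :
    Tendsto (fun h : ℂ => h⁻¹ • (genSchwartz (w + h) - genSchwartz w)) (𝓝[≠] 0)
      (𝓝 (genSchwartzDeriv w)) := by
  rw [(schwartz_withSeminorms ℂ ℝ ℂ).tendsto_nhds]
  rintro ⟨k, n⟩ ε hε
  obtain ⟨C, hC⟩ := exists_seminorm_genSchwartz_sub_le w k n
  have h1 : Tendsto (fun h : ℂ => C * ‖h‖) (𝓝[≠] 0) (𝓝 0) := by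
    have : Continuous fun h : ℂ => C * ‖h‖ := by fun_prop
    simpa using (this.tendsto 0).mono_left nhdsWithin_le_nhds
  have h2 : ∀ᶠ h : ℂ in 𝓝[≠] 0, ‖h‖ ≤ 1 :=
    nhdsWithin_le_nhds (continuous_norm.tendsto' (0 : ℂ) 0 norm_zero |>.eventually_le_const one_pos)
  filter_upwards [h1.eventually_lt_const hε, h2, self_mem_nhdsWithin] with h hlt hle hne
  have hne' : h ≠ 0 := hne
  have e : h⁻¹ • (genSchwartz (w + h) - genSchwartz w) - genSchwartzDeriv w =
      h⁻¹ • (genSchwartz (w + h) - genSchwartz w - h • genSchwartzDeriv w) := by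
    rw [smul_sub _ _ (h • _), inv_smul_smul₀ hne']
  rw [e, map_smul_eq_mul]
  refine lt_of_le_of_lt ?_ hlt
  have hpos : 0 < ‖h‖ := norm_pos_iff.2 hne'
  rw [norm_inv, inv_mul_le_iff₀ hpos]
  refine (hC h hle).trans (le_of_eq ?_)
  ring

theorem hasDerivAt_genSchwartz (y : 𝓢'(ℝ, ℂ)) (w : ℂ) :
    HasDerivAt (fun w => y (genSchwartz w)) (y (genSchwartzDeriv w)) w := by
  rw [hasDerivAt_iff_tendsto_slope_zero]
  have h := ((map_continuous y).tendsto _).comp (tendsto_slope_genSchwartz w)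
  refine h.congr fun t => ?_
  simp only [Function.comp_apply]
  rw [map_smul y, map_sub y]

/-! ### Bargmann kernels -/

/-- `t ↦ 2^{1/4} e^{-πt² + 2πtw - πw²/2}`, as a Schwartz function. -/
noncomputable def kernel (w : ℂ) : 𝓢(ℝ, ℂ) := cexp (-Real.pi * w ^ 2 / 2) • genSchwartz w

/-- The derivative of `kernel` with respect to its parameter. -/
noncomputable def kernelDeriv (w : ℂ) : 𝓢(ℝ, ℂ) :=
  SchwartzMap.smulLeftCLM ℂ (fun t : ℝ => (2 * Real.pi : ℂ) * t + -Real.pi * w) (kernel w)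

theorem kernel_apply (w : ℂ) (t : ℝ) : kernel w t = ((2 : ℝ) ^ (1 / 4 : ℝ) : ℝ) *
    cexp (-Real.pi * t ^ 2 + 2 * Real.pi * t * w - Real.pi * w ^ 2 / 2) := by
  rw [kernel, smul_apply, genSchwartz_apply, smul_eq_mul, mul_left_comm,
    ← Complex.exp_add]
  congr 2
  ring

theorem kernelDeriv_apply (w : ℂ) (t : ℝ) :
    kernelDeriv w t = (2 * Real.pi * t - Real.pi * w) * kernel w t := by
  rw [kernelDeriv, SchwartzMap.smulLeftCLM_apply_apply (hasTemperateGrowth_affine _ _),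
    smul_eq_mul]
  ring

theorem kernelDeriv_eq (w : ℂ) : kernelDeriv w = cexp (-Real.pi * w ^ 2 / 2) •
    (genSchwartzDeriv w - (Real.pi * w : ℂ) • genSchwartz w) := by
  ext t
  rw [kernelDeriv_apply, kernel, smul_apply, smul_apply,
    sub_apply, smul_apply, genSchwartzDeriv_apply]
  simp only [smul_eq_mul]
  ring

theorem hasDerivAt_kernel (y : 𝓢'(ℝ, ℂ)) (w : ℂ) :
    HasDerivAt (fun w => y (kernel w)) (y (kernelDeriv w)) w := by
  have h1 : HasDerivAt (fun w : ℂ => cexp (-Real.pi * w ^ 2 / 2))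
      (cexp (-Real.pi * w ^ 2 / 2) * (-Real.pi * w)) w := by
    have := (((hasDerivAt_pow 2 w).const_mul (-Real.pi : ℂ)).div_const 2).cexp
    refine this.congr_deriv ?_
    push_cast
    ring
  have h2 := h1.mul (hasDerivAt_genSchwartz y w)
  have e : (fun w => y (kernel w)) =
      (fun w : ℂ => cexp (-Real.pi * w ^ 2 / 2)) * fun w => y (genSchwartz w) := by
    ext v
    rw [kernel, map_smul y]
    rfl
  rw [e]
  refine h2.congr_deriv ?_
  rw [kernelDeriv_eq, map_smul y, map_sub y, map_smul y]
  simp only [smul_eq_mul]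
  ring

theorem differentiable_kernel (y : 𝓢'(ℝ, ℂ)) : Differentiable ℂ fun w => y (kernel w) :=
  fun w => (hasDerivAt_kernel y w).differentiableAt

theorem conj_kernel (w : ℂ) (t : ℝ) :
    (starRingEnd ℂ) (kernel w t) = kernel ((starRingEnd ℂ) w) t := by
  rw [kernel_apply, kernel_apply, map_mul, conj_ofReal, ← exp_conj]
  simp [Complex.conj_ofNat]

theorem conj_kernelDeriv (w : ℂ) (t : ℝ) :
    (starRingEnd ℂ) (kernelDeriv w t) = kernelDeriv ((starRingEnd ℂ) w) t := by
  rw [kernelDeriv_apply, kernelDeriv_apply, map_mul, conj_kernel]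
  simp [Complex.conj_ofNat]

theorem kernel_conj_eq_smul_atom (z : ℂ) : ∃ c : ℂ, c ≠ 0 ∧
    kernel ((starRingEnd ℂ) z) = c • atom z := by
  refine ⟨cexp (-Real.pi * ((starRingEnd ℂ) z) ^ 2 / 2) *
    cexp (Real.pi * ((starRingEnd ℂ) z).re ^ 2), mul_ne_zero (exp_ne_zero _) (exp_ne_zero _), ?_⟩
  rw [kernel, genSchwartz, smul_smul, conj_conj]

end Bargmann

section InnerProducts

/-! ### Inner products of Bargmann kernels -/

theorem two_rpow_quarter_sq_mul :
    (((2 : ℝ) ^ (1 / 4 : ℝ) : ℝ) : ℂ) ^ 2 * (1 / 2 : ℂ) ^ (1 / 2 : ℂ) = 1 := by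
  have h : (1 / 2 : ℂ) ^ (1 / 2 : ℂ) = (((1 / 2 : ℝ) ^ (1 / 2 : ℝ) : ℝ) : ℂ) := by
    rw [ofReal_cpow (by norm_num)]
    norm_num
  rw [h, ← ofReal_pow, ← ofReal_mul, ← Real.rpow_natCast, ← Real.rpow_mul (by norm_num),
    show (1 / 4 : ℝ) * (2 : ℕ) = 1 / 2 by norm_num, ← Real.mul_rpow (by norm_num) (by norm_num)]
  norm_num

/-- Gaussian integral. The bilinear form, without conjugation, is holomorphic in both parameters and
so can be differentiated below. -/
theorem integral_kernel_mul_kernel (w u : ℂ) :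
    ∫ t, kernel w t * kernel u t = cexp (Real.pi * w * u) := by
  set c₀ : ℂ := (((2 : ℝ) ^ (1 / 4 : ℝ) : ℝ) : ℂ) with hc₀
  have hpi : (Real.pi : ℂ) ≠ 0 := by exact_mod_cast Real.pi_ne_zero
  have h1 : ∀ t : ℝ, kernel w t * kernel u t = c₀ ^ 2 * cexp (-(2 * Real.pi : ℂ) * t ^ 2 +
      (2 * Real.pi * (w + u)) * t + (-Real.pi * w ^ 2 / 2 - Real.pi * u ^ 2 / 2)) := fun t => by
    rw [kernel_apply, kernel_apply, mul_mul_mul_comm, ← Complex.exp_add, ← sq]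
    congr 2
    ring
  simp_rw [h1]
  rw [integral_const_mul, integral_cexp_quadratic (by simp [Real.pi_pos]), ← mul_assoc,
    show (Real.pi : ℂ) / -(-(2 * Real.pi)) = 1 / 2 by field_simp, hc₀, two_rpow_quarter_sq_mul,
    one_mul]
  congr 1
  field_simp
  ring

theorem toTemperedDistribution_schwartz_apply (f g : 𝓢(ℝ, ℂ)) :
    SchwartzMap.toTemperedDistributionCLM ℝ ℂ volume f g = ∫ t, g t * f t :=
  SchwartzMap.toTemperedDistributionCLM_apply_apply volume f g

/-- Differentiation under the integral comes from `hasDerivAt_kernel` applied to `kernel u` viewed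
as a tempered distribution. -/
theorem integral_kernelDeriv_mul_kernel (w u : ℂ) :
    ∫ t, kernelDeriv w t * kernel u t = Real.pi * u * cexp (Real.pi * w * u) := by
  have h1 := hasDerivAt_kernel (SchwartzMap.toTemperedDistributionCLM ℝ ℂ volume (kernel u)) w
  simp only [toTemperedDistribution_schwartz_apply, integral_kernel_mul_kernel] at h1
  have h2 : HasDerivAt (fun w : ℂ => cexp (Real.pi * w * u))
      (Real.pi * u * cexp (Real.pi * w * u)) w := by
    refine ((((hasDerivAt_id w).const_mul (Real.pi : ℂ)).mul_const u).cexp).congr_deriv ?_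
    simp only [id]
    ring
  exact h1.unique h2

theorem integral_kernelDeriv_mul_kernelDeriv (w u : ℂ) :
    ∫ t, kernelDeriv w t * kernelDeriv u t =
      (Real.pi + Real.pi ^ 2 * w * u) * cexp (Real.pi * w * u) := by
  have h1 := hasDerivAt_kernel
    (SchwartzMap.toTemperedDistributionCLM ℝ ℂ volume (kernelDeriv u)) w
  simp only [toTemperedDistribution_schwartz_apply, mul_comm (kernel _ _),
    integral_kernelDeriv_mul_kernel] at h1
  have h2 : HasDerivAt (fun w : ℂ => Real.pi * w * cexp (Real.pi * u * w))
      ((Real.pi + Real.pi ^ 2 * w * u) * cexp (Real.pi * w * u)) w := by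
    refine (((hasDerivAt_id w).const_mul (Real.pi : ℂ)).mul
      ((hasDerivAt_id w).const_mul (Real.pi * u : ℂ)).cexp).congr_deriv ?_
    simp only [id]
    rw [show (Real.pi : ℂ) * u * w = Real.pi * w * u by ring]
    ring
  exact h1.unique h2

theorem inner_kernel_kernel (u w : ℂ) : inner ℂ (toL2 (kernel u)) (toL2 (kernel w)) =
    cexp (Real.pi * w * (starRingEnd ℂ) u) := by
  simp_rw [inner_toL2, conj_kernel, integral_kernel_mul_kernel]

theorem inner_kernel_kernelDeriv (u w : ℂ) : inner ℂ (toL2 (kernel u)) (toL2 (kernelDeriv w)) =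
    Real.pi * (starRingEnd ℂ) u * cexp (Real.pi * w * (starRingEnd ℂ) u) := by
  simp_rw [inner_toL2, conj_kernel, integral_kernelDeriv_mul_kernel]

theorem inner_kernelDeriv_self (w : ℂ) :
    inner ℂ (toL2 (kernelDeriv w)) (toL2 (kernelDeriv w)) =
      (Real.pi + Real.pi ^ 2 * w * (starRingEnd ℂ) w) * cexp (Real.pi * w * (starRingEnd ℂ) w) := by
  simp_rw [inner_toL2, conj_kernelDeriv, integral_kernelDeriv_mul_kernelDeriv]

theorem cexp_pi_mul_conj (w : ℂ) : cexp (Real.pi * w * (starRingEnd ℂ) w) =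
    ((Real.exp (Real.pi * ‖w‖ ^ 2) : ℝ) : ℂ) := by
  rw [mul_assoc, mul_conj']
  push_cast
  rfl

theorem norm_toL2_kernelDeriv_sq (w : ℂ) : ‖toL2 (kernelDeriv w)‖ ^ 2 =
    (Real.pi + Real.pi ^ 2 * ‖w‖ ^ 2) * Real.exp (Real.pi * ‖w‖ ^ 2) := by
  have h := inner_self_eq_norm_sq_to_K (𝕜 := ℂ) (toL2 (kernelDeriv w))
  rw [inner_kernelDeriv_self, cexp_pi_mul_conj, mul_assoc ((Real.pi : ℂ) ^ 2), mul_conj'] at h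
  have h' : (((Real.pi + Real.pi ^ 2 * ‖w‖ ^ 2) * Real.exp (Real.pi * ‖w‖ ^ 2) : ℝ) : ℂ) =
      ((‖toL2 (kernelDeriv w)‖ ^ 2 : ℝ) : ℂ) := by
    push_cast at h ⊢
    exact h
  exact_mod_cast h'.symm

/-- The reproducing kernel `exp(π w ū)` is constant in `w` at `u = 0`. This orthogonality splits off
the independent Gaussian constant term. -/
theorem inner_kernel_zero_sub (w : ℂ) :
    inner ℂ (toL2 (kernel 0)) (toL2 (kernel w - kernel 0)) = 0 := by
  rw [map_sub, inner_sub_right, inner_kernel_kernel, inner_kernel_kernel]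
  simp

theorem inner_kernel_zero_kernelDeriv (w : ℂ) :
    inner ℂ (toL2 (kernel 0)) (toL2 (kernelDeriv w)) = 0 := by
  rw [inner_kernel_kernelDeriv]
  simp

theorem norm_toL2_kernel_zero : ‖toL2 (kernel 0)‖₊ ^ 2 = 1 := by
  have h := inner_self_eq_norm_sq_to_K (𝕜 := ℂ) (toL2 (kernel 0))
  rw [inner_kernel_kernel] at h
  have h' : ((1 : ℝ) : ℂ) = ((‖toL2 (kernel 0)‖ ^ 2 : ℝ) : ℂ) := by
    push_cast
    simpa using h
  have h2 : ‖toL2 (kernel 0)‖ ^ 2 = 1 := by exact_mod_cast h'.symm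
  exact NNReal.eq (by simpa using h2)

theorem norm_toL2_kernel_sub_sq (w : ℂ) : ‖toL2 (kernel w - kernel 0)‖ ^ 2 =
    Real.exp (Real.pi * ‖w‖ ^ 2) - 1 := by
  have h := inner_self_eq_norm_sq_to_K (𝕜 := ℂ) (toL2 (kernel w - kernel 0))
  rw [map_sub, inner_sub_left, inner_sub_right, inner_sub_right, inner_kernel_kernel,
    inner_kernel_kernel, inner_kernel_kernel, inner_kernel_kernel, cexp_pi_mul_conj] at h
  have h' : ((Real.exp (Real.pi * ‖w‖ ^ 2) - 1 : ℝ) : ℂ) =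
      ((‖toL2 (kernel w - kernel 0)‖ ^ 2 : ℝ) : ℂ) := by
    rw [map_sub]
    push_cast at h ⊢
    simpa using h
  exact_mod_cast h'.symm

theorem inner_kernel_sub_kernelDeriv (w : ℂ) :
    inner ℂ (toL2 (kernel w - kernel 0)) (toL2 (kernelDeriv w)) =
      Real.pi * (starRingEnd ℂ) w * (Real.exp (Real.pi * ‖w‖ ^ 2) : ℝ) := by
  rw [map_sub, inner_sub_left, inner_kernel_zero_kernelDeriv, sub_zero, inner_kernel_kernelDeriv,
    cexp_pi_mul_conj]

end InnerProducts

/-! ### Intensity of the zeros for noise plus a deterministic signal. -/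

section Noise

variable {Ω : Type*} [MeasurableSpace Ω] {μ : Measure Ω} [IsProbabilityMeasure μ]
  {ξ : Ω → 𝓢'(ℝ, ℂ)}

/-- One plus the variance of `ξ(kernel w - kernel 0)` is `exp(π|w|²)`, which produces the weight. At
`w = 0` this variable degenerates and has no density, hence the exclusion. -/
theorem IsComplexWhiteNoise.lintegral_kernel (hξ : IsComplexWhiteNoise μ ξ) {w : ℂ} (hw : w ≠ 0)
    (m β : ℂ) :
    ∫⁻ ω, ENNReal.ofReal (Real.pi⁻¹ * Real.exp (-‖ξ ω (kernel w - kernel 0) + m‖ ^ 2) *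
        ‖ξ ω (kernelDeriv w) + β‖ ^ 2) ∂μ =
      ENNReal.ofReal ((1 + ‖β - Real.pi * (starRingEnd ℂ) w * m‖ ^ 2 / Real.pi *
        Real.exp (-Real.pi * ‖w‖ ^ 2)) *
          Real.exp (-(‖m‖ ^ 2 * Real.exp (-Real.pi * ‖w‖ ^ 2)))) := by
  have hpi := Real.pi_pos
  have hwpos : 0 < ‖w‖ := norm_pos_iff.2 hw
  have hne : toL2 (kernel w - kernel 0) ≠ 0 := by
    intro h0
    have h1 := norm_toL2_kernel_sub_sq w
    rw [h0, norm_zero, zero_pow two_ne_zero] at h1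
    have h2 : 1 < Real.exp (Real.pi * ‖w‖ ^ 2) := Real.one_lt_exp_iff.2 (by positivity)
    linarith
  rw [hξ.lintegral_exp_neg_mul hne, norm_toL2_kernel_sub_sq, norm_toL2_kernelDeriv_sq,
    inner_kernel_sub_kernelDeriv,
    show Real.exp (-Real.pi * ‖w‖ ^ 2) = (Real.exp (Real.pi * ‖w‖ ^ 2))⁻¹ by
      rw [neg_mul, Real.exp_neg]]
  have hc : (1 : ℂ) + ((‖toL2 (kernel w - kernel 0)‖ : ℝ) : ℂ) ^ 2 =
      ((Real.exp (Real.pi * ‖w‖ ^ 2) : ℝ) : ℂ) := by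
    rw [← ofReal_pow, norm_toL2_kernel_sub_sq]
    push_cast
    ring
  rw [hc]
  set K : ℝ := Real.exp (Real.pi * ‖w‖ ^ 2) with hK
  have hK0 : 0 < K := Real.exp_pos _
  have hKc : (K : ℂ) ≠ 0 := by exact_mod_cast hK0.ne'
  rw [add_sub_cancel, show (Real.pi : ℂ) * (starRingEnd ℂ) w * K * m / K =
    Real.pi * (starRingEnd ℂ) w * m by field_simp]
  have hn : ‖(Real.pi : ℂ) * (starRingEnd ℂ) w * K‖ = Real.pi * ‖w‖ * K := by
    rw [norm_mul, norm_mul, Complex.norm_real, Complex.norm_real, norm_conj,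
      Real.norm_of_nonneg hpi.le, Real.norm_of_nonneg hK0.le]
  rw [hn, div_eq_mul_inv (‖m‖ ^ 2)]
  -- The summand 1 is the normalised conditional variance: with `K = exp(π|w|²)`, `(π + π²|w|²)K -
  -- π²|w|²K = πK`, divided by `πK`.
  congr 1
  field_simp
  ring

/-- Expected number of zeros of the Bargmann transform of the noise plus a deterministic signal. -/
theorem IsComplexWhiteNoise.lintegral_count_zeros (hξ : IsComplexWhiteNoise μ ξ) (x : 𝓢'(ℝ, ℂ))
    {A : Set ℂ} (hA : MeasurableSet A) (hAb : Bornology.IsBounded A) :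
    ∫⁻ ω, Measure.count (A ∩ (fun w => (ξ ω + x) (kernel w)) ⁻¹' {0}) ∂μ =
      ∫⁻ w in A, ENNReal.ofReal ((1 + ‖x (kernelDeriv w) -
        Real.pi * (starRingEnd ℂ) w * x (kernel w)‖ ^ 2 / Real.pi *
        Real.exp (-Real.pi * ‖w‖ ^ 2)) *
          Real.exp (-(‖x (kernel w)‖ ^ 2 * Real.exp (-Real.pi * ‖w‖ ^ 2)))) := by
  -- Distributions carry only the σ-algebra of evaluations at test functions orthogonal to `kernel
  -- 0`. For it, `ξ` as a whole is independent of `ξ(kernel 0)`, and `f` still depends measurably on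
  -- `ξ`.
  let r : 𝓢'(ℝ, ℂ) → {φ : 𝓢(ℝ, ℂ) // inner ℂ (toL2 (kernel 0)) (toL2 φ) = 0} → ℂ :=
    fun y φ => y φ.1
  let _ : MeasurableSpace 𝓢'(ℝ, ℂ) := MeasurableSpace.comap r inferInstance
  have hr : Measurable r := comap_measurable r
  have hev : ∀ φ : 𝓢(ℝ, ℂ), inner ℂ (toL2 (kernel 0)) (toL2 φ) = 0 →
      Measurable fun y : 𝓢'(ℝ, ℂ) => y φ := fun φ hφ =>
    (measurable_pi_apply (⟨φ, hφ⟩ : {φ : 𝓢(ℝ, ℂ) //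
      inner ℂ (toL2 (kernel 0)) (toL2 φ) = 0})).comp hr
  have hT : Measurable ξ := by
    rw [measurable_comap_iff]
    exact measurable_pi_lambda _ fun φ => hξ.measurable φ
  have hind : IndepFun (fun ω => ξ ω (kernel 0)) ξ μ := by
    have h := hξ.indepFun (kernel 0)
    rw [IndepFun_iff_Indep] at h ⊢
    rwa [MeasurableSpace.comap_comp]
  let f : 𝓢'(ℝ, ℂ) → ℂ → ℂ := fun y w => y (kernel w - kernel 0) + x (kernel w)
  have hfd : ∀ y w, HasDerivAt (f y) (y (kernelDeriv w) + x (kernelDeriv w)) w := by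
    intro y w
    have h1 := ((hasDerivAt_kernel y w).sub_const (y (kernel 0))).add (hasDerivAt_kernel x w)
    have e : f y = (fun w => y (kernel w) - y (kernel 0)) + fun w => x (kernel w) := by
      ext w
      change y (kernel w - kernel 0) + x (kernel w) = _
      rw [map_sub y]
      rfl
    rw [e]
    exact h1
  have hlaw : μ.map (fun ω => ξ ω (kernel 0)) = complexGaussian 1 := by
    rw [hξ.map_eq, norm_toL2_kernel_zero]
  have hdf : ∀ y w, deriv (f y) w = y (kernelDeriv w) + x (kernelDeriv w) :=
    fun y w => (hfd y w).deriv
  have key := ChirpZeros.lintegral_count_zeros (hξ.measurable (kernel 0)) hT hind hlaw (f := f)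
    (fun y w => (hfd y w).differentiableAt)
    (fun w => (hev _ (inner_kernel_zero_sub w)).add_const _)
    (fun w => by
      simp_rw [hdf]
      exact (hev _ (inner_kernel_zero_kernelDeriv w)).add_const _) hA hAb
  have hL : ∀ ω w, ξ ω (kernel 0) + f (ξ ω) w = (ξ ω + x) (kernel w) := by
    intro ω w
    change ξ ω (kernel 0) + (ξ ω (kernel w - kernel 0) + x (kernel w)) =
      ξ ω (kernel w) + x (kernel w)
    rw [map_sub (ξ ω)]
    ring
  simp_rw [hL] at key
  rw [key]
  refine setLIntegral_congr_fun_ae hA ?_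
  have h0 : ∀ᵐ w : ℂ, w ≠ 0 := by simp [ae_iff]
  filter_upwards [h0] with w hw _
  simp_rw [hdf]
  exact hξ.lintegral_kernel hw _ _

end Noise

section Chirp

/-! ### The Bargmann transform of the linear chirp -/

theorem one_sub_ne_zero (b : ℝ) : (1 - 2 * b * I : ℂ) ≠ 0 := by
  intro h
  have := congrArg re h
  simp at this

theorem chirpDistribution_kernel (a b : ℝ) (w : ℂ) : chirpDistribution a b (kernel w) =
    (((2 : ℝ) ^ (1 / 4 : ℝ) : ℝ) : ℂ) * (1 / (1 - 2 * b * I) : ℂ) ^ (1 / 2 : ℂ) *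
      cexp (Real.pi * (w + I * a) ^ 2 / (1 - 2 * b * I) - Real.pi * w ^ 2 / 2) := by
  have hpi : (Real.pi : ℂ) ≠ 0 := by exact_mod_cast Real.pi_ne_zero
  have hb := one_sub_ne_zero b
  have h0 : chirpDistribution a b (kernel w) = ∫ t, kernel w t • chirp a b t :=
    Function.HasTemperateGrowth.toTemperedDistribution_apply volume (hasTemperateGrowth_chirp a b) _
  have h1 : ∀ t : ℝ, kernel w t • chirp a b t = (((2 : ℝ) ^ (1 / 4 : ℝ) : ℝ) : ℂ) *
      cexp (-(Real.pi * (1 - 2 * b * I)) * t ^ 2 + (2 * Real.pi * (w + I * a)) * t +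
        (-Real.pi * w ^ 2 / 2)) := fun t => by
    rw [kernel_apply, chirp, smul_eq_mul, mul_assoc, ← Complex.exp_add]
    congr 2
    ring
  rw [h0]
  simp_rw [h1]
  rw [integral_const_mul, integral_cexp_quadratic (by simp [Real.pi_pos]), ← mul_assoc]
  congr 2
  · congr 1
    field_simp
  · field_simp
    ring

theorem chirpDistribution_kernelDeriv (a b : ℝ) (w : ℂ) :
    chirpDistribution a b (kernelDeriv w) = chirpDistribution a b (kernel w) *
      (2 * Real.pi * (w + I * a) / (1 - 2 * b * I) - Real.pi * w) := by
  have h1 := hasDerivAt_kernel (chirpDistribution a b) w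
  have e : (fun w => chirpDistribution a b (kernel w)) = fun w =>
      (((2 : ℝ) ^ (1 / 4 : ℝ) : ℝ) : ℂ) * (1 / (1 - 2 * b * I) : ℂ) ^ (1 / 2 : ℂ) *
        cexp (Real.pi * (w + I * a) ^ 2 / (1 - 2 * b * I) - Real.pi * w ^ 2 / 2) :=
    funext (chirpDistribution_kernel a b)
  rw [e] at h1
  have h2 := (((((((hasDerivAt_id w).add_const (I * a)).pow 2).const_mul (Real.pi : ℂ)).div_const
    (1 - 2 * b * I)).sub (((hasDerivAt_pow 2 w).const_mul (Real.pi : ℂ)).div_const 2)).cexp).const_mul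
      ((((2 : ℝ) ^ (1 / 4 : ℝ) : ℝ) : ℂ) * (1 / (1 - 2 * b * I) : ℂ) ^ (1 / 2 : ℂ))
  rw [h1.unique h2, chirpDistribution_kernel]
  simp only [id, Pi.sub_apply, Pi.pow_apply]
  push_cast
  ring

theorem sigma_sq (b : ℝ) : sigma b ^ 2 = 2 / (1 + 4 * b ^ 2) :=
  Real.sq_sqrt (by positivity)

theorem sigma_pos (b : ℝ) : 0 < sigma b := Real.sqrt_pos.2 (by positivity)

theorem chirpCoord_sq (a b : ℝ) (z : ℂ) :
    chirpCoord a b z ^ 2 = (z.im - (a + 2 * b * z.re)) ^ 2 / (1 + 4 * b ^ 2) := by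
  rw [chirpCoord, mul_pow, div_pow, sigma_sq, Real.sq_sqrt (by norm_num)]
  field_simp

theorem normSq_one_sub (b : ℝ) : normSq (1 - 2 * b * I) = 1 + 4 * b ^ 2 := by
  simp [normSq_apply]
  ring

theorem norm_chirp_const_sq (b : ℝ) :
    ‖(((2 : ℝ) ^ (1 / 4 : ℝ) : ℝ) : ℂ) * (1 / (1 - 2 * b * I) : ℂ) ^ (1 / 2 : ℂ)‖ ^ 2 =
      sigma b := by
  have hb := one_sub_ne_zero b
  have hsq : ‖((1 / (1 - 2 * b * I) : ℂ) ^ (1 / 2 : ℂ))‖ ^ 2 = ‖(1 / (1 - 2 * b * I) : ℂ)‖ := by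
    rw [← norm_pow, ← cpow_nat_mul]
    norm_num
  have h2 : ((2 : ℝ) ^ (1 / 4 : ℝ)) ^ 2 = Real.sqrt 2 := by
    rw [← Real.rpow_natCast, ← Real.rpow_mul (by norm_num), Real.sqrt_eq_rpow]
    norm_num
  rw [norm_mul, mul_pow, hsq, Complex.norm_real, Real.norm_of_nonneg (by positivity), h2,
    norm_div, norm_one, Complex.norm_def, normSq_one_sub, sigma, Real.sqrt_div (by norm_num)]
  ring

theorem div_one_sub (b : ℝ) (v : ℂ) :
    v / (1 - 2 * b * I) = v * (1 + 2 * b * I) / ((1 + 4 * b ^ 2 : ℝ) : ℂ) := by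
  have hb := one_sub_ne_zero b
  have h1 : ((1 + 4 * b ^ 2 : ℝ) : ℂ) = (1 - 2 * b * I) * (1 + 2 * b * I) := by
    push_cast
    linear_combination 4 * (b : ℂ) ^ 2 * I_sq
  have h2 : ((1 + 4 * b ^ 2 : ℝ) : ℂ) ≠ 0 := by
    exact_mod_cast (by positivity : (0 : ℝ) < 1 + 4 * b ^ 2).ne'
  rw [div_eq_div_iff hb h2, h1]
  ring

theorem norm_chirpDistribution_kernel_sq (a b : ℝ) (z : ℂ) :
    ‖chirpDistribution a b (kernel ((starRingEnd ℂ) z))‖ ^ 2 * Real.exp (-Real.pi * ‖z‖ ^ 2) =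
      sigma b * Real.exp (-2 * Real.pi * chirpCoord a b z ^ 2) := by
  rw [chirpDistribution_kernel, norm_mul, mul_pow, norm_chirp_const_sq, norm_exp, ← Real.exp_nat_mul,
    mul_assoc, ← Real.exp_add, chirpCoord_sq]
  congr 2
  have hp : (1 : ℝ) + 4 * b ^ 2 ≠ 0 := by positivity
  rw [div_one_sub, sub_re, div_ofReal_re, Complex.sq_norm, normSq_apply]
  simp only [sq, mul_re, mul_im, add_re, add_im, ofReal_re, ofReal_im, conj_re, conj_im, I_re, I_im,
    one_re, one_im, re_ofNat, im_ofNat, div_ofNat_re]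
  push_cast
  field_simp
  ring

/-- Over the common denominator `1 - 2bi` the expression collapses to `-2πi (ω - a - 2bτ)/(1 -
2bi)`: the terms holomorphic and antiholomorphic in `z` combine into a real quantity vanishing on
the chirp line. -/
theorem norm_chirp_log_deriv_sq (a b : ℝ) (z : ℂ) :
    ‖2 * Real.pi * ((starRingEnd ℂ) z + I * a) / (1 - 2 * b * I) - Real.pi * (starRingEnd ℂ) z -
      Real.pi * z‖ ^ 2 = 4 * Real.pi ^ 2 * chirpCoord a b z ^ 2 := by
  have hb := one_sub_ne_zero b
  have h : 2 * Real.pi * ((starRingEnd ℂ) z + I * a) / (1 - 2 * b * I) -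
      Real.pi * (starRingEnd ℂ) z - Real.pi * z =
      ((2 * Real.pi * (z.im - (a + 2 * b * z.re)) : ℝ) : ℂ) * (-I) / (1 - 2 * b * I) := by
    rw [eq_div_iff hb, sub_mul, sub_mul, div_mul_cancel₀ _ hb]
    have hz : z = z.re + z.im * I := (re_add_im z).symm
    have hz' : (starRingEnd ℂ) z = z.re - z.im * I := by apply Complex.ext <;> simp
    rw [hz']
    generalize z.re = τ at *
    generalize z.im = ω at *
    subst hz
    push_cast
    ring
  rw [h, norm_div, norm_mul, norm_neg, norm_I, mul_one, Complex.norm_real, div_pow, Real.norm_eq_abs, sq_abs,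
    Complex.sq_norm, normSq_one_sub, chirpCoord_sq]
  ring

end Chirp

section Intensity

/-! ### Zeros of the spectrogram -/

/-- Atoms and kernels at conjugate points are nonzero multiples of each other, and conjugation,
being injective, preserves cardinality. -/
theorem zeroCount_eq_count (y : 𝓢'(ℝ, ℂ)) {A : Set ℂ} (hA : MeasurableSet A) :
    zeroCount y A =
      Measure.count ((starRingEnd ℂ) ⁻¹' A ∩ (fun w => y (kernel w)) ⁻¹' {0}) := by
  have hm : MeasurableSet ((starRingEnd ℂ) ⁻¹' A ∩ (fun w => y (kernel w)) ⁻¹' {0}) :=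
    (continuous_conj.measurable hA).inter
      ((differentiable_kernel y).continuous.measurable (measurableSet_singleton 0))
  have hzero : ∀ z, spectrogram y z = 0 ↔ y (kernel ((starRingEnd ℂ) z)) = 0 := by
    intro z
    obtain ⟨c, hc, h⟩ := kernel_conj_eq_smul_atom z
    rw [spectrogram, h, map_smul y, smul_eq_mul, sq_eq_zero_iff, norm_eq_zero]
    simp [hc]
  have himage : {z : ℂ | z ∈ A ∧ spectrogram y z = 0} =
      (starRingEnd ℂ) '' ((starRingEnd ℂ) ⁻¹' A ∩ (fun w => y (kernel w)) ⁻¹' {0}) := by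
    ext z
    constructor
    · rintro ⟨hz, h0⟩
      exact ⟨(starRingEnd ℂ) z, ⟨by simpa using hz, (hzero z).1 h0⟩, conj_conj z⟩
    · rintro ⟨w, ⟨hw, h0⟩, rfl⟩
      refine ⟨hw, (hzero _).2 ?_⟩
      rw [conj_conj]
      exact h0
  rw [zeroCount, Measure.count_apply hm, himage,
    (starRingEnd ℂ).injective.injOn.encard_image]

theorem setLIntegral_conj {A : Set ℂ} (φ : ℂ → ℝ≥0∞) :
    ∫⁻ w in (starRingEnd ℂ) ⁻¹' A, φ w = ∫⁻ z in A, φ ((starRingEnd ℂ) z) := by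
  have h := (conjLIE.measurePreserving).setLIntegral_comp_preimage_emb
    conjLIE.toHomeomorph.measurableEmbedding (fun z => φ ((starRingEnd ℂ) z)) A
  rw [← h]
  refine lintegral_congr fun w => ?_
  simp

theorem isBounded_conj_preimage {A : Set ℂ} (hA : Bornology.IsBounded A) :
    Bornology.IsBounded ((starRingEnd ℂ) ⁻¹' A) := by
  obtain ⟨R, hR⟩ := hA.exists_norm_le
  exact isBounded_iff_forall_norm_le.2 ⟨R, fun w hw => by simpa using hR _ hw⟩

theorem chirp_density_eq (a b γ : ℝ) (hγ : 0 < γ) (z : ℂ) :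
    (1 + ‖(((Real.sqrt γ : ℂ) • chirpDistribution a b : 𝓢'(ℝ, ℂ)))
        (kernelDeriv ((starRingEnd ℂ) z)) - Real.pi * (starRingEnd ℂ) ((starRingEnd ℂ) z) *
        (((Real.sqrt γ : ℂ) • chirpDistribution a b : 𝓢'(ℝ, ℂ)))
          (kernel ((starRingEnd ℂ) z))‖ ^ 2 / Real.pi *
        Real.exp (-Real.pi * ‖(starRingEnd ℂ) z‖ ^ 2)) *
      Real.exp (-(‖(((Real.sqrt γ : ℂ) • chirpDistribution a b : 𝓢'(ℝ, ℂ)))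
        (kernel ((starRingEnd ℂ) z))‖ ^ 2 * Real.exp (-Real.pi * ‖(starRingEnd ℂ) z‖ ^ 2))) =
      zeroDensity b γ (chirpCoord a b z) := by
  have hs : ∀ φ, ((Real.sqrt γ : ℂ) • chirpDistribution a b : 𝓢'(ℝ, ℂ)) φ =
      Real.sqrt γ * chirpDistribution a b φ := fun φ => rfl
  have hg : ‖((Real.sqrt γ : ℝ) : ℂ)‖ ^ 2 = γ := by
    rw [Complex.norm_real, Real.norm_eq_abs, sq_abs, Real.sq_sqrt hγ.le]
  set M := chirpDistribution a b (kernel ((starRingEnd ℂ) z)) with hM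
  have h1 : ‖(Real.sqrt γ : ℂ) * M‖ ^ 2 * Real.exp (-Real.pi * ‖z‖ ^ 2) =
      γ * (sigma b * Real.exp (-2 * Real.pi * chirpCoord a b z ^ 2)) := by
    rw [norm_mul, mul_pow, hg, mul_assoc, hM, norm_chirpDistribution_kernel_sq]
  rw [norm_conj, conj_conj, hs, hs, chirpDistribution_kernelDeriv, ← hM,
    -- Factoring out the signal leaves the shifted logarithmic derivative, so both exponentials
    -- involve the same quantity `γσ_b exp(-2πr²)`.
    show (Real.sqrt γ : ℂ) * (M * (2 * Real.pi * ((starRingEnd ℂ) z + I * a) / (1 - 2 * b * I) -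
      Real.pi * (starRingEnd ℂ) z)) - Real.pi * z * (Real.sqrt γ * M) =
      (Real.sqrt γ * M) * (2 * Real.pi * ((starRingEnd ℂ) z + I * a) / (1 - 2 * b * I) -
      Real.pi * (starRingEnd ℂ) z - Real.pi * z) by ring,
    norm_mul, mul_pow, norm_chirp_log_deriv_sq, div_mul_eq_mul_div, mul_right_comm, h1, zeroDensity]
  have hpi := Real.pi_ne_zero
  congr 2
  · field_simp
  · ring

/-! ### Distance to the chirp line -/

theorem abs_chirpCoord_eq_infDist (a b : ℝ) (z : ℂ) :
    |chirpCoord a b z| = Metric.infDist z (chirpLine a b) := by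
  set N : ℝ := 1 + 4 * b ^ 2 with hN
  have hN0 : 0 < N := by positivity
  set d : ℝ := z.im - (a + 2 * b * z.re) with hd
  have hr : chirpCoord a b z ^ 2 = d ^ 2 / N := chirpCoord_sq a b z
  -- Foot of the perpendicular from `z` to the line.
  set p : ℂ := ⟨z.re + 2 * b * d / N, z.im - d / N⟩ with hp
  have hpm : p ∈ chirpLine a b := by
    change z.im - d / N = a + 2 * b * (z.re + 2 * b * d / N)
    field_simp
    rw [hd, hN]
    ring
  apply le_antisymm
  · refine (Metric.le_infDist ⟨p, hpm⟩).2 fun q hq => ?_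
    refine abs_le_of_sq_le_sq ?_ dist_nonneg
    have hq' : q.im = a + 2 * b * q.re := hq
    rw [hr, dist_eq, Complex.sq_norm, normSq_apply, div_le_iff₀ hN0, sub_re, sub_im]
    have e : d = (z.im - q.im) - 2 * b * (z.re - q.re) := by rw [hd, hq']; ring
    rw [e, hN]
    -- Cauchy–Schwarz for `z - q` against the normal vector `(-2b, 1)`; the hint is the square of
    -- the component along the line.
    nlinarith [sq_nonneg ((z.re - q.re) + 2 * b * (z.im - q.im))]
  · refine (Metric.infDist_le_dist_of_mem hpm).trans ?_
    rw [← abs_of_nonneg (dist_nonneg (x := z) (y := p))]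
    refine sq_le_sq.1 (le_of_eq ?_)
    rw [hr, dist_eq, Complex.sq_norm, normSq_apply, sub_re, sub_im]
    simp only [hp]
    field_simp
    rw [hN]
    ring

theorem chirpCoord_pos_iff (a b : ℝ) (z : ℂ) :
    0 < chirpCoord a b z ↔ a + 2 * b * z.re < z.im := by
  have h : 0 < sigma b / Real.sqrt 2 := div_pos (sigma_pos b) (by positivity)
  rw [chirpCoord, mul_pos_iff_of_pos_left h, sub_pos]

theorem continuous_zeroDensity_chirpCoord (a b γ : ℝ) :
    Continuous fun z => zeroDensity b γ (chirpCoord a b z) := by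
  unfold zeroDensity chirpCoord
  fun_prop

theorem zeroDensity_nonneg {b γ : ℝ} (hγ : 0 ≤ γ) (r : ℝ) : 0 ≤ zeroDensity b γ r := by
  have := sigma_pos b
  have := Real.pi_pos
  unfold zeroDensity
  positivity

end Intensity

end ChirpZeros

theorem proposition4 {Ω : Type*} [MeasurableSpace Ω] (μ : Measure Ω) [IsProbabilityMeasure μ]
    (ξ : Ω → 𝓢'(ℝ, ℂ)) (hξ : ChirpZeros.IsComplexWhiteNoise μ ξ)
    (a b γ : ℝ) (hγ : 0 < γ) :
    -- the zeros of the spectrogram of the noisy chirp have a density that depends on r only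
    ChirpZeros.HasZeroIntensity μ
      (fun ω => ξ ω + (Real.sqrt γ : ℂ) • ChirpZeros.chirpDistribution a b)
      (fun z => ChirpZeros.zeroDensity b γ (ChirpZeros.chirpCoord a b z)) ∧
    -- r is the signed distance between z and the line
    ∀ z : ℂ,
      |ChirpZeros.chirpCoord a b z| = Metric.infDist z (ChirpZeros.chirpLine a b) ∧
      (0 < ChirpZeros.chirpCoord a b z ↔ a + 2 * b * z.re < z.im) := by
  refine ⟨⟨(ChirpZeros.continuous_zeroDensity_chirpCoord a b γ).measurable,
    fun z => ChirpZeros.zeroDensity_nonneg hγ.le _, fun A hAb hA => ?_, fun A hAb hA => ?_⟩,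
    fun z => ⟨ChirpZeros.abs_chirpCoord_eq_infDist a b z, ChirpZeros.chirpCoord_pos_iff a b z⟩⟩
  · simp_rw [ChirpZeros.zeroCount_eq_count _ hA]
    exact (ChirpZeros.measurable_count_zeros
      (fun ω => ChirpZeros.differentiable_kernel _)
      (fun w => (hξ.measurable (ChirpZeros.kernel w)).add_const _)
      (continuous_conj.measurable hA) (ChirpZeros.isBounded_conj_preimage hAb)).aemeasurable
  · simp_rw [ChirpZeros.zeroCount_eq_count _ hA]
    rw [hξ.lintegral_count_zeros _ (continuous_conj.measurable hA)
      (ChirpZeros.isBounded_conj_preimage hAb), ChirpZeros.setLIntegral_conj]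
    simp_rw [ChirpZeros.chirp_density_eq a b γ hγ]
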